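/- Consider a loss server (no buffer) with $C\ge 1$ threads. Forwarded tasks reach the server according to a Poisson process of rate $\lambda>0$ whose increments are independent of the past of the system. A task arriving when at least one thread is idle occupies exactly one idle thread; a task arriving when all threads are busy is discarded; idle threads become busy in no other way. Let $c(t)\in\{0,\dots,C\}$ be the number of idle threads at time $t$. (a) For every service mechanism in which (almost surely) no thread is released at an arrival instant: if the system is in steady state (the law of $c(t)$ does not depend on $t$), then the hazard rate of resource exhaustion, i.e. the rate of the transitions of $c$ from $1$ to $0$, is $$\Lambda=\lambda\,\Pr\{c(t)=1\},$$ that is, for every $t\ge 0$ the probability of such a transition during $(t,t+h]$ is $\Lambda h+o(h)$ as $h\downarrow 0$, and for all $s\le t$ the expected number of such transitions during $(s,t]$ is $\Lambda(t-s)$. (b) Suppose in addition that each thread serves at rate $\mu>0$: service times are independent and exponential with mean $1/\mu$, realised by independent Poisson processes of rate $\mu$, one per thread, independent of the arrivals and of the past, where a busy thread completes its task at the next point of its process. Let $\rho=\lambda/\mu$ and $B(\rho,n)=\dfrac{\rho^n/n!}{\sum_{k=0}^{n}\rho^k/k!}$. Then the steady-state probability that exactly one thread is idle is $$P_1=\Pr\{c(t)=1\}=\frac{\rho^{C-1}/(C-1)!}{\sum_{k=0}^{C}\rho^k/k!}=B(\rho,C-1)\,\bigl(1-B(\rho,C)\bigr),$$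 and the hazard rate of resource exhaustion in steady state is $\Lambda=\lambda P_1$. Moreover, from every initial state, $\Pr\{c(t)=1\}\to P_1$, and the expected number of transitions from $1$ to $0$ during $(0,t]$, divided by $t$, tends to $\lambda P_1$, as $t\to\infty$. -/

import Mathlib

open MeasureTheory ProbabilityTheory Filter Set Topology
open scoped NNReal ENNReal

/-- The Erlang-B formula `B(ρ, C) = (ρ ^ C / C!) / ∑_{k=0}^{C} ρ ^ k / k!`. -/
noncomputable def erlangB (ρ : ℝ) (C : ℕ) : ℝ :=
  (ρ ^ C / (C.factorial : ℝ)) / ∑ k ∈ Finset.range (C + 1), ρ ^ k / (k.factorial : ℝ)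

/-- The path of a counting process: it starts at `0`, is nondecreasing and right-continuous. -/
structure IsCountingPath (a : ℝ≥0 → ℕ) : Prop where
  zero : a 0 = 0
  mono : Monotone a
  right_cont : ∀ u, ∀ᶠ v in 𝓝[>] u, a v = a u

/-- The counting path `a` has a point at time `u` (used for `u > 0` only). -/
def HasPointAt (a : ℝ≥0 → ℕ) (u : ℝ≥0) : Prop := ¬ ∀ᶠ v in 𝓝[<] u, a v = a u

/-- `N` is a Poisson process of rate `r` with respect to the history `ℱ`: it is a counting process
adapted to `ℱ`, its increment over `(s, t]` is Poisson distributed with mean `r * (t - s)`, and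
this increment is independent of the history up to time `s`. -/
structure IsPoissonStream {Ω : Type*} {m : MeasurableSpace Ω} (ℱ : Filtration ℝ≥0 m)
    (P : Measure Ω) (r : ℝ≥0) (N : ℝ≥0 → Ω → ℕ) : Prop where
  adapted : ∀ t, Measurable[ℱ t] (N t)
  path : ∀ᵐ ω ∂P, IsCountingPath (fun t => N t ω)
  law : ∀ s t, s ≤ t → P.map (fun ω => N t ω - N s ω) = poissonMeasure (r * (t - s))
  indep : ∀ s t, s ≤ t →
    Indep (MeasurableSpace.comap (fun ω => N t ω - N s ω) ⊤) (ℱ s) P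

/-- The evolution of the set `I t` of idle threads of a server without buffer, when tasks arrive
at the points of `a`. Let `J` be the set of idle threads just before time `u`. If a task arrives
at `u`, it is discarded when `J = ∅`, and otherwise it occupies exactly one of the threads in `J`.
If no task arrives at `u`, threads can only become idle at `u` (service completions).
Neither the service times nor the choice of the thread is restricted. -/
structure IsLossPath {C : ℕ} (a : ℝ≥0 → ℕ) (I : ℝ≥0 → Finset (Fin C)) : Prop where
  right_cont : ∀ u, ∀ᶠ v in 𝓝[>] u, I v = I u
  step : ∀ u, 0 < u → ∃ J : Finset (Fin C), (∀ᶠ v in 𝓝[<] u, I v = J) ∧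
    (HasPointAt a u → (J = ∅ ∧ I u = ∅) ∨ ∃ i ∈ J, I u = J.erase i) ∧
    (¬ HasPointAt a u → J ⊆ I u)

/-- A pure-loss server with `C` threads, fed by the Poisson stream `A` of forwarded tasks of rate
`lam`; `idle t` is the random set of idle threads at time `t`. The increments of `A` are
independent of the past of the whole system; the service mechanism is arbitrary. -/
structure IsLossServer {Ω : Type*} {m : MeasurableSpace Ω} (ℱ : Filtration ℝ≥0 m)
    (P : Measure Ω) (C : ℕ) (lam : ℝ≥0) (A : ℝ≥0 → Ω → ℕ)
    (idle : ℝ≥0 → Ω → Finset (Fin C)) : Prop where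
  arrivals : IsPoissonStream ℱ P lam A
  adapted : ∀ t I, MeasurableSet[ℱ t] {ω | idle t ω = I}
  path : ∀ᵐ ω ∂P, IsLossPath (fun t => A t ω) (fun t => idle t ω)

/-- Every thread works at (exponential) service rate `mu`: thread `i` carries a Poisson process
`D i` of rate `mu`, the processes `A, D 0, …, D (C - 1)` are independent of each other and of the
past, and whenever thread `i` is busy it completes its task at the next point of `D i`. Hence
service times are i.i.d. exponential with mean `1 / mu`; the points of `D i` at which thread `i`
is idle have no effect. -/
structure HasServiceRate {Ω : Type*} {m : MeasurableSpace Ω} (ℱ : Filtration ℝ≥0 m)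
    (P : Measure Ω) (C : ℕ) (mu : ℝ≥0) (A : ℝ≥0 → Ω → ℕ)
    (D : Fin C → ℝ≥0 → Ω → ℕ) (idle : ℝ≥0 → Ω → Finset (Fin C)) : Prop where
  clocks : ∀ i, IsPoissonStream ℱ P mu (D i)
  indep_past : ∀ s t, s ≤ t →
    Indep (MeasurableSpace.comap
      (fun ω (j : Option (Fin C)) =>
        j.elim (A t ω - A s ω) (fun i => D i t ω - D i s ω)) MeasurableSpace.pi) (ℱ s) P
  indep_clocks : ∀ s t, s ≤ t →
    iIndepFun (fun (j : Option (Fin C)) ω =>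
      j.elim (A t ω - A s ω) (fun i => D i t ω - D i s ω)) P
  completion : ∀ᵐ ω ∂P, ∀ u, 0 < u → ¬ HasPointAt (fun t => A t ω) u →
    ∀ i, i ∈ idle u ω ↔ (∀ᶠ v in 𝓝[<] u, i ∈ idle v ω) ∨ HasPointAt (fun t => D i t ω) u

/-- The number of idle threads `c(t)`. -/
def idleCount {Ω : Type*} {C : ℕ} (idle : ℝ≥0 → Ω → Finset (Fin C)) (t : ℝ≥0) (ω : Ω) : ℕ :=
  (idle t ω).card

/-- The system is in steady state: the law of the number of idle threads does not change. -/
def InSteadyState {Ω : Type*} {m : MeasurableSpace Ω} (P : Measure Ω) (c : ℝ≥0 → Ω → ℕ) : Prop :=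
  ∀ t k, P {ω | c t ω = k} = P {ω | c 0 ω = k}

/-- The times in `(s, t]` at which the path `x` jumps from `1` to `0`. -/
def exhaustionTimes (x : ℝ≥0 → ℕ) (s t : ℝ≥0) : Set ℝ≥0 :=
  {u | u ∈ Ioc s t ∧ (∀ᶠ v in 𝓝[<] u, x v = 1) ∧ x u = 0}

/-- The expected number of jumps of `c` from `1` to `0` during `(s, t]`. -/
noncomputable def meanExhaustions {Ω : Type*} {m : MeasurableSpace Ω} (P : Measure Ω)
    (c : ℝ≥0 → Ω → ℕ) (s t : ℝ≥0) : ℝ≥0∞ :=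
  ∫⁻ ω, ((exhaustionTimes (fun u => c u ω) s t).encard : ℝ≥0∞) ∂P

/-- `Λ` is the (unconditional) rate at which `c` jumps from `1` to `0`: the probability of such a
jump during `(t, t + h]` is `Λ * h + o(h)` as `h ↓ 0`, for every `t`, and the expected number of
such jumps during `(s, t]` is `Λ * (t - s)`. -/
structure IsExhaustionRate {Ω : Type*} {m : MeasurableSpace Ω} (P : Measure Ω)
    (c : ℝ≥0 → Ω → ℕ) (Λ : ℝ) : Prop where
  instantaneous : ∀ t : ℝ≥0, Tendsto
    (fun h : ℝ≥0 => P.real {ω | (exhaustionTimes (fun u => c u ω) t (t + h)).Nonempty} / (h : ℝ))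
    (𝓝[>] 0) (𝓝 Λ)
  mean : ∀ s t : ℝ≥0, s ≤ t →
    meanExhaustions P c s t = ENNReal.ofReal (Λ * ((t : ℝ) - (s : ℝ)))

/-! An exhaustion is exactly an arrival that finds one idle thread. Cut `(s, t]` into `n` equal
cells: for large `n`, the exhaustions are as many as the cells that start with one idle thread and
contain an arrival (`IsLossPath.eventually_encard_exhaustionTimes`). Arrivals in a cell are
independent of the state at its left end, so dominated convergence expresses the mean number of
exhaustions through the values of `Pr{c = 1}` on the grid (`IsLossServer.tendsto_meanExhaustions`).
In steady state these values agree and the mean is `λ Pr{c = 1} (t - s)`. The probability of a jump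
differs from the mean by `O(h²)`, because a second jump needs a second arrival.

With exponential service, two points of the arrival stream and the clocks fall into a time `d` with
probability `O(d²)`. Hence the distribution function of `c` obeys the birth–death forward equation
up to a uniform `O(d²)` error (`HasServiceRate.exists_forward_bound`). The Erlang weights solve that
equation by detailed balance, and the `ℓ¹` distance of distribution functions contracts by `1 - d μ`
per step (`sum_abs_birth_death_step_le`). Letting `d → 0` gives decay `exp (-μ t)` from any initial
law. This identifies the steady state, and the long-run average follows by squeezing the mean count
between bounds on `Pr{c = 1}`. -/

/-! ### Points and jumps of right-continuous step paths. -/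

/-- A function that is locally constant from both sides on `[s, t]` takes the same value at the
end points. -/
lemma eq_of_eventually_eq_left_right {α : Type*} {x : ℝ≥0 → α} {s t : ℝ≥0} (hst : s ≤ t)
    (hr : ∀ u, ∀ᶠ v in 𝓝[>] u, x v = x u)
    (hl : ∀ u ∈ Ioc s t, ∀ᶠ v in 𝓝[<] u, x v = x u) : x t = x s := by
  -- For the discrete topology the one-sided conditions say that `x` is continuous on the connected
  -- set `Icc s t`.
  let _ : TopologicalSpace α := ⊥
  have : DiscreteTopology α := ⟨rfl⟩
  refine isPreconnected_Icc.constant (s := Icc s t) (f := x) ?_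
    (right_mem_Icc.2 hst) (left_mem_Icc.2 hst)
  intro u hu
  have h : ∀ᶠ v in 𝓝[Icc s t] u, x u = x v := by
    have h1 := eventually_nhdsWithin_iff.1 (hr u)
    have h2 : ∀ᶠ v in 𝓝 u, v ∈ Icc s t → v < u → x v = x u := by
      rcases eq_or_lt_of_le hu.1 with h | h
      · exact Eventually.of_forall fun v hv hvu => absurd (h ▸ hvu) (not_lt.2 hv.1)
      · exact (eventually_nhdsWithin_iff.1 (hl u ⟨h, hu.2⟩)).mono fun v hv _ => hv
    rw [eventually_nhdsWithin_iff]
    filter_upwards [h1, h2] with v h1 h2 hv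
    rcases lt_trichotomy v u with h | h | h
    · exact (h2 hv h).symm
    · rw [h]
    · exact (h1 h).symm
  exact tendsto_const_nhds.congr' h

/-- A path that is locally constant on `[s, t]` except for a jump at `u₀`. -/
lemma eq_of_single_jump {α : Type*} {x : ℝ≥0 → α} {s t u₀ : ℝ≥0} {J : α} (hu : u₀ ∈ Ioc s t)
    (hr : ∀ u, ∀ᶠ v in 𝓝[>] u, x v = x u)
    (hl : ∀ u ∈ Ioc s t, u ≠ u₀ → ∀ᶠ v in 𝓝[<] u, x v = x u)
    (hJ : ∀ᶠ v in 𝓝[<] u₀, x v = J) : J = x s ∧ x t = x u₀ := by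
  constructor
  · have : (𝓝[<] u₀).NeBot := nhdsLT_neBot_of_exists_lt ⟨s, hu.1⟩
    obtain ⟨v, hv, hv'⟩ := (hJ.and (Ioo_mem_nhdsLT hu.1)).exists
    rw [← hv]
    exact eq_of_eventually_eq_left_right hv'.1.le hr fun u hu' =>
      hl u ⟨hu'.1, hu'.2.trans (hv'.2.le.trans hu.2)⟩ (hu'.2.trans_lt hv'.2).ne
  · exact eq_of_eventually_eq_left_right hu.2 hr fun u hu' =>
      hl u ⟨hu.1.trans hu'.1, hu'.2⟩ hu'.1.ne'

lemma HasPointAt.lt {a : ℝ≥0 → ℕ} (ha : Monotone a) {u v : ℝ≥0} (h : HasPointAt a u)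
    (hvu : v < u) : a v < a u := by
  by_contra hlt
  refine h ?_
  filter_upwards [Ioo_mem_nhdsLT hvu] with w hw
  exact le_antisymm (ha hw.2.le) ((not_lt.1 hlt).trans (ha hw.1.le))

lemma not_hasPointAt_of_eq {a : ℝ≥0 → ℕ} (ha : Monotone a) {s t u : ℝ≥0} (h : a t = a s)
    (hu : u ∈ Ioc s t) : ¬ HasPointAt a u := fun hp =>
  absurd (hp.lt ha hu.1) (not_lt.2 (h ▸ ha hu.2))

lemma IsCountingPath.exists_hasPointAt {a : ℝ≥0 → ℕ} (ha : IsCountingPath a) {s t : ℝ≥0}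
    (h : a s < a t) : ∃ u ∈ Ioc s t, HasPointAt a u := by
  by_contra! hn
  have hst : s ≤ t := le_of_not_ge fun hle => absurd (ha.mono hle) (not_le.2 h)
  exact h.ne' (eq_of_eventually_eq_left_right hst ha.right_cont fun u hu => not_not.1 (hn u hu))

lemma IsCountingPath.exists_unique_hasPointAt {a : ℝ≥0 → ℕ} (ha : IsCountingPath a) {s t : ℝ≥0}
    (h : a t = a s + 1) :
    ∃ u ∈ Ioc s t, HasPointAt a u ∧ ∀ v ∈ Ioc s t, v ≠ u → ¬ HasPointAt a v := by
  obtain ⟨u, hu, hp⟩ := ha.exists_hasPointAt (s := s) (t := t) (by omega)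
  refine ⟨u, hu, hp, fun v hv hne hq => ?_⟩
  -- Each point raises `a` by at least one, so two points would give a rise of at least two.
  rcases lt_or_gt_of_ne hne with hlt | hlt
  · have h1 := hq.lt ha.mono hv.1
    have h2 := hp.lt ha.mono hlt
    have h3 := ha.mono hu.2
    omega
  · have h1 := hp.lt ha.mono hu.1
    have h2 := hq.lt ha.mono hlt
    have h3 := ha.mono hv.2
    omega

/-- The path increases strictly from one of its points to the next, so it maps them injectively into
the integers of `Ioc (a s) (a t)`. -/
lemma encard_hasPointAt_le {a : ℝ≥0 → ℕ} (ha : Monotone a) (s t : ℝ≥0) :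
    {u | u ∈ Ioc s t ∧ HasPointAt a u}.encard ≤ ((a t - a s : ℕ) : ℕ∞) := by
  have h : (Ioc (a s) (a t)).encard = ((a t - a s : ℕ) : ℕ∞) := by
    rw [← Finset.coe_Ioc, Set.encard_coe_eq_coe_finsetCard, Nat.card_Ioc]
  rw [← h]
  refine Set.encard_le_encard_of_injOn (f := a) (fun u hu => ?_) ?_
  · exact ⟨hu.2.lt ha hu.1.1, ha hu.1.2⟩
  · intro u hu v hv huv
    rcases lt_trichotomy u v with hlt | hlt | hlt
    · exact absurd huv (hv.2.lt ha hlt).ne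
    · exact hlt
    · exact absurd huv (hu.2.lt ha hlt).ne'

/-! ### Pathwise evolution of the idle set. -/

section LossPath

variable {C : ℕ} {a : ℝ≥0 → ℕ} {I : ℝ≥0 → Finset (Fin C)}

/-- Resources are exhausted exactly by the arrivals that find one idle thread. -/
lemma IsLossPath.mem_exhaustionTimes_iff (hI : IsLossPath a I) {s t u : ℝ≥0} :
    u ∈ exhaustionTimes (fun v => (I v).card) s t ↔
      u ∈ Ioc s t ∧ HasPointAt a u ∧ ∀ᶠ v in 𝓝[<] u, (I v).card = 1 := by
  simp only [exhaustionTimes, mem_ofPred_eq]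
  refine and_congr_right fun hu => ?_
  have hu0 : 0 < u := (zero_le).trans_lt hu.1
  have : (𝓝[<] u).NeBot := nhdsLT_neBot_of_exists_lt ⟨0, hu0⟩
  obtain ⟨J, hJ, hp, hq⟩ := hI.step u hu0
  constructor
  · rintro ⟨h1, h0⟩
    refine ⟨?_, h1⟩
    by_contra hn
    obtain ⟨v, hv, hv'⟩ := (hJ.and h1).exists
    have := Finset.card_le_card (hq hn)
    rw [hv] at hv'
    omega
  · rintro ⟨hpt, h1⟩
    refine ⟨h1, ?_⟩
    obtain ⟨v, hv, hv'⟩ := (hJ.and h1).exists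
    rw [hv] at hv'
    rcases hp hpt with ⟨h, _⟩ | ⟨i, hi, h⟩
    · simp [h] at hv'
    · rw [h, Finset.card_erase_of_mem hi, hv']

variable {d : Fin C → ℝ≥0 → ℕ} {s t : ℝ≥0}

lemma IsLossPath.eventually_eq_left (hI : IsLossPath a I)
    (hc : ∀ u, 0 < u → ¬ HasPointAt a u →
      ∀ i, i ∈ I u ↔ (∀ᶠ v in 𝓝[<] u, i ∈ I v) ∨ HasPointAt (d i) u) {u : ℝ≥0} (hu : 0 < u)
    (ha : ¬ HasPointAt a u) (hd : ∀ i, ¬ HasPointAt (d i) u) :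
    ∀ᶠ v in 𝓝[<] u, I v = I u := by
  have : (𝓝[<] u).NeBot := nhdsLT_neBot_of_exists_lt ⟨0, hu⟩
  obtain ⟨J, hJ, -, -⟩ := hI.step u hu
  have : I u = J := by
    ext i
    rw [hc u hu ha i, or_iff_left (hd i)]
    constructor
    · intro h
      obtain ⟨v, hv, hv'⟩ := (hJ.and h).exists
      rwa [← hv]
    · intro h
      filter_upwards [hJ] with v hv
      rwa [hv]
  rwa [this]

lemma IsLossPath.eq_of_no_points (hI : IsLossPath a I)
    (hc : ∀ u, 0 < u → ¬ HasPointAt a u →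
      ∀ i, i ∈ I u ↔ (∀ᶠ v in 𝓝[<] u, i ∈ I v) ∨ HasPointAt (d i) u)
    (ha : IsCountingPath a) (hd : ∀ i, IsCountingPath (d i)) (hst : s ≤ t)
    (hat : a t = a s) (hdt : ∀ i, d i t = d i s) : I t = I s :=
  eq_of_eventually_eq_left_right hst hI.right_cont fun _ hu =>
    hI.eventually_eq_left hc ((zero_le).trans_lt hu.1) (not_hasPointAt_of_eq ha.mono hat hu)
      fun i => not_hasPointAt_of_eq (hd i).mono (hdt i) hu

/-- Truncated subtraction covers the discarded task: with no idle thread the count stays at `0`. -/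
lemma IsLossPath.card_of_one_arrival (hI : IsLossPath a I)
    (hc : ∀ u, 0 < u → ¬ HasPointAt a u →
      ∀ i, i ∈ I u ↔ (∀ᶠ v in 𝓝[<] u, i ∈ I v) ∨ HasPointAt (d i) u)
    (ha : IsCountingPath a) (hd : ∀ i, IsCountingPath (d i))
    (hat : a t = a s + 1) (hdt : ∀ i, d i t = d i s) : (I t).card = (I s).card - 1 := by
  obtain ⟨u, hu, hp, hq⟩ := ha.exists_unique_hasPointAt hat
  obtain ⟨J, hJ, hstep, -⟩ := hI.step u ((zero_le).trans_lt hu.1)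
  obtain ⟨h1, h2⟩ := eq_of_single_jump hu hI.right_cont (fun v hv hne =>
    hI.eventually_eq_left hc ((zero_le).trans_lt hv.1) (hq v hv hne)
      fun i => not_hasPointAt_of_eq (hd i).mono (hdt i) hv) hJ
  rw [← h1, h2]
  rcases hstep hp with ⟨h, h'⟩ | ⟨i, hi, h⟩
  · simp [h, h']
  · rw [h, Finset.card_erase_of_mem hi]

/-- Using `insert` also covers a clock that rings while its thread is already idle. -/
lemma IsLossPath.eq_insert_of_one_completion (hI : IsLossPath a I)
    (hc : ∀ u, 0 < u → ¬ HasPointAt a u →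
      ∀ i, i ∈ I u ↔ (∀ᶠ v in 𝓝[<] u, i ∈ I v) ∨ HasPointAt (d i) u)
    (ha : IsCountingPath a) (hd : ∀ i, IsCountingPath (d i)) (i : Fin C)
    (hat : a t = a s) (hit : d i t = d i s + 1) (hdt : ∀ j ≠ i, d j t = d j s) :
    I t = insert i (I s) := by
  obtain ⟨u, hu, hp, hq⟩ := (hd i).exists_unique_hasPointAt hit
  have hu0 : 0 < u := (zero_le).trans_lt hu.1
  have : (𝓝[<] u).NeBot := nhdsLT_neBot_of_exists_lt ⟨0, hu0⟩
  obtain ⟨J, hJ, -, -⟩ := hI.step u hu0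
  obtain ⟨h1, h2⟩ := eq_of_single_jump hu hI.right_cont (fun v hv hne =>
    hI.eventually_eq_left hc ((zero_le).trans_lt hv.1) (not_hasPointAt_of_eq ha.mono hat hv)
      fun j => by
        by_cases hji : j = i
        · exact hji ▸ hq v hv hne
        · exact not_hasPointAt_of_eq (hd j).mono (hdt j hji) hv) hJ
  rw [← h1, h2]
  ext j
  rw [hc u hu0 (not_hasPointAt_of_eq ha.mono hat hu) j, Finset.mem_insert, or_comm]
  refine or_congr ?_ ?_
  · by_cases hji : j = i
    · simpa [hji] using hp
    · simpa [hji] using not_hasPointAt_of_eq (hd j).mono (hdt j hji) hu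
  · constructor
    · intro h
      obtain ⟨v, hv, hv'⟩ := (hJ.and h).exists
      rwa [← hv]
    · intro h
      filter_upwards [hJ] with v hv
      rwa [hv]

end LossPath

/-! ### Counting exhaustions on a grid. -/

/-- The `i`-th point of the partition of `[s, t]` into `n` intervals of equal length. -/
noncomputable def gridPoint (s t : ℝ≥0) (n i : ℕ) : ℝ≥0 := s + (t - s) / n * i

lemma gridPoint_zero (s t : ℝ≥0) (n : ℕ) : gridPoint s t n 0 = s := by simp [gridPoint]

lemma gridPoint_self {s t : ℝ≥0} (hst : s ≤ t) {n : ℕ} (hn : n ≠ 0) : gridPoint s t n n = t := by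
  rw [gridPoint, div_mul_cancel₀ _ (by exact_mod_cast hn), add_tsub_cancel_of_le hst]

lemma gridPoint_succ (s t : ℝ≥0) (n i : ℕ) :
    gridPoint s t n (i + 1) = gridPoint s t n i + (t - s) / n := by
  simp only [gridPoint]; push_cast; ring

lemma gridPoint_mono (s t : ℝ≥0) (n : ℕ) : Monotone (gridPoint s t n) :=
  monotone_nat_of_le_succ fun i => by rw [gridPoint_succ]; exact le_self_add

lemma le_gridPoint (s t : ℝ≥0) (n i : ℕ) : s ≤ gridPoint s t n i := le_self_add

lemma gridPoint_le {s t : ℝ≥0} (hst : s ≤ t) {n i : ℕ} (hi : i ≤ n) : gridPoint s t n i ≤ t := by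
  rcases Nat.eq_zero_or_pos n with rfl | hn
  · simpa [gridPoint] using hst
  · exact (gridPoint_mono s t n hi).trans_eq (gridPoint_self hst hn.ne')

lemma exists_gridPoint_lt_le {s t u : ℝ≥0} (hu : u ∈ Ioc s t) {n : ℕ} (hn : n ≠ 0) :
    ∃ i < n, gridPoint s t n i < u ∧ u ≤ gridPoint s t n (i + 1) := by
  classical
  have hst : s ≤ t := hu.1.le.trans hu.2
  have hex : ∃ j, u ≤ gridPoint s t n j := ⟨n, by rw [gridPoint_self hst hn]; exact hu.2⟩
  have hle : Nat.find hex ≤ n := Nat.find_min' hex (by rw [gridPoint_self hst hn]; exact hu.2)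
  have hpos : Nat.find hex ≠ 0 := fun h0 => by
    have := Nat.find_spec hex
    rw [h0, gridPoint_zero] at this
    exact absurd hu.1 (not_lt.2 this)
  obtain ⟨i, hi⟩ := Nat.exists_eq_succ_of_ne_zero hpos
  refine ⟨i, by omega, not_le.1 (Nat.find_min hex (by omega)), ?_⟩
  have := Nat.find_spec hex
  rwa [hi] at this

/-- On a sufficiently fine grid, exhaustions are counted by the grid intervals that start with
one idle thread and contain an arrival. -/
lemma IsLossPath.eventually_encard_exhaustionTimes {C : ℕ} {a : ℝ≥0 → ℕ}
    {I : ℝ≥0 → Finset (Fin C)} (ha : IsCountingPath a) (hI : IsLossPath a I) {s t : ℝ≥0}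
    (hst : s ≤ t) :
    ∀ᶠ n : ℕ in atTop, (exhaustionTimes (fun v => (I v).card) s t).encard =
      (((Finset.range n).filter fun i => (I (gridPoint s t n i)).card = 1 ∧
        a (gridPoint s t n i) < a (gridPoint s t n (i + 1))).card : ℕ∞) := by
  set F : Set ℝ≥0 := {u | u ∈ Ioc s t ∧ HasPointAt a u} with hF
  have hfin : F.Finite := Set.finite_of_encard_le_coe (encard_hasPointAt_le ha.mono s t)
  have hmesh : Tendsto (fun n : ℕ => (t - s) / (n : ℝ≥0)) atTop (𝓝 0) :=
    tendsto_const_div_atTop_nhds_zero_nat (t - s)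
  -- There are finitely many arrivals, so one mesh serves them all: it is shorter than a stretch
  -- before each arrival `u` on which `I` is constant. The left end of the cell of `u` then already
  -- shows the state just before `u`.
  have hloc : ∀ᶠ n : ℕ in atTop, ∀ u ∈ F, ∃ J : Finset (Fin C), (∀ᶠ v in 𝓝[<] u, I v = J) ∧
      ∀ v, v < u → u ≤ v + (t - s) / n → I v = J := by
    rw [hfin.eventually_all]
    intro u hu
    have hu0 : 0 < u := (zero_le).trans_lt hu.1.1
    obtain ⟨J, hJ, -, -⟩ := hI.step u hu0
    obtain ⟨w, hw, hwu⟩ := (mem_nhdsLT_iff_exists_Ioo_subset' hu0).1 hJ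
    filter_upwards [hmesh.eventually_lt_const (tsub_pos_of_lt hw)] with n hn
    refine ⟨J, hJ, fun v hv hv' => hwu ⟨?_, hv⟩⟩
    by_contra hvw
    have h1 : v + (t - s) / n < w + (u - w) := add_lt_add_of_le_of_lt (not_lt.1 hvw) hn
    rw [add_tsub_cancel_of_le (le_of_lt hw)] at h1
    exact absurd hv' (not_le.2 h1)
  filter_upwards [hloc, eventually_ne_atTop 0] with n hn hn0
  rw [← Set.encard_coe_eq_coe_finsetCard]
  have key : ∀ u ∈ F, ∀ i, gridPoint s t n i < u → u ≤ gridPoint s t n (i + 1) →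
      ((∀ᶠ v in 𝓝[<] u, (I v).card = 1) ↔ (I (gridPoint s t n i)).card = 1) := by
    intro u hu i h1 h2
    have : (𝓝[<] u).NeBot := nhdsLT_neBot_of_exists_lt ⟨s, hu.1.1⟩
    obtain ⟨J, hJ, hJ'⟩ := hn u hu
    rw [hJ' _ h1 (by rwa [← gridPoint_succ])]
    constructor
    · intro h
      obtain ⟨v, hv, hv'⟩ := (hJ.and h).exists
      rwa [← hv]
    · intro h
      filter_upwards [hJ] with v hv
      rwa [hv]
  apply le_antisymm
  · choose! f hf using fun u (hu : u ∈ Ioc s t) => exists_gridPoint_lt_le hu hn0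
    refine Set.encard_le_encard_of_injOn (f := f) (fun u hu => ?_) ?_
    · obtain ⟨hu1, hu2, hu3⟩ := hI.mem_exhaustionTimes_iff.1 hu
      obtain ⟨h1, h2, h3⟩ := hf u hu1
      simp only [Finset.coe_filter, Finset.mem_range, mem_ofPred_eq]
      exact ⟨h1, (key u ⟨hu1, hu2⟩ _ h2 h3).1 hu3, (hu2.lt ha.mono h2).trans_le (ha.mono h3)⟩
    -- If exhaustions `u < v` shared a cell, the state at `u`, with no idle thread, would be the
    -- state just before `v`, with one.
    · have aux : ∀ u ∈ exhaustionTimes (fun v => (I v).card) s t,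
          ∀ v ∈ exhaustionTimes (fun v => (I v).card) s t, f u = f v → ¬ u < v := by
        intro u hu v hv huv hlt
        obtain ⟨hv1, hv2, hv3⟩ := hI.mem_exhaustionTimes_iff.1 hv
        obtain ⟨-, h2, h3⟩ := hf v hv1
        obtain ⟨-, h5, -⟩ := hf u hu.1
        rw [huv] at h5
        obtain ⟨J, hJ, hJ'⟩ := hn v ⟨hv1, hv2⟩
        rw [gridPoint_succ] at h3
        have e1 := hJ' _ h2 h3
        have e2 := hJ' u hlt (h3.trans (by gcongr))
        have e3 := (key v ⟨hv1, hv2⟩ _ h2 (by rwa [gridPoint_succ])).1 hv3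
        rw [e1, ← e2] at e3
        have e4 : (I u).card = 0 := hu.2.2
        omega
      intro u hu v hv huv
      exact le_antisymm (not_lt.1 (aux v hv u hu huv.symm)) (not_lt.1 (aux u hu v hv huv))
  · have hex : ∀ i ∈ ((Finset.range n).filter fun i => (I (gridPoint s t n i)).card = 1 ∧
        a (gridPoint s t n i) < a (gridPoint s t n (i + 1)) : Set ℕ),
        ∃ u ∈ Ioc (gridPoint s t n i) (gridPoint s t n (i + 1)), HasPointAt a u := fun i hi =>
      ha.exists_hasPointAt (by simpa using (Finset.mem_filter.1 hi).2.2)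
    choose! f hf hf' using hex
    refine Set.encard_le_encard_of_injOn (f := f) (fun i hi => ?_) ?_
    · have hi' := Finset.mem_filter.1 (Finset.mem_coe.1 hi)
      have hin : i + 1 ≤ n := Finset.mem_range.1 hi'.1
      have hmem : f i ∈ Ioc s t :=
        ⟨(le_gridPoint s t n i).trans_lt (hf i hi).1, (hf i hi).2.trans (gridPoint_le hst hin)⟩
      exact hI.mem_exhaustionTimes_iff.2 ⟨hmem, hf' i hi,
        (key _ ⟨hmem, hf' i hi⟩ i (hf i hi).1 (hf i hi).2).2 hi'.2.1⟩
    · intro i hi j hj hij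
      have h1 := hf i hi
      have h2 := hf j hj
      rw [hij] at h1
      rcases lt_trichotomy i j with h | h | h
      · exact absurd (h1.2.trans (gridPoint_mono s t n h)) (not_le.2 h2.1)
      · exact h
      · exact absurd (h2.2.trans (gridPoint_mono s t n h)) (not_le.2 h1.1)

/-- Every counted cell contributes at least one to the telescoping sum of increments. The bound does
not depend on `n` and serves as the dominating function. -/
lemma card_grid_increments_le {a : ℝ≥0 → ℕ} (ha : Monotone a) {s t : ℝ≥0} (hst : s ≤ t) (n : ℕ)
    (p : ℕ → Prop) [DecidablePred p] :
    ((Finset.range n).filter fun i => p i ∧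
      a (gridPoint s t n i) < a (gridPoint s t n (i + 1))).card ≤ a t - a s := by
  have h1 : ((Finset.range n).filter fun i => p i ∧
      a (gridPoint s t n i) < a (gridPoint s t n (i + 1))).card ≤
      ∑ i ∈ Finset.range n, (a (gridPoint s t n (i + 1)) - a (gridPoint s t n i)) := by
    rw [Finset.card_filter]
    refine Finset.sum_le_sum fun i _ => ?_
    split_ifs with h <;> omega
  refine h1.trans ?_
  have hm : Monotone fun i => a (gridPoint s t n i) := ha.comp (gridPoint_mono s t n)
  rw [Finset.sum_range_tsub hm, gridPoint_zero]
  have := ha (gridPoint_le hst le_rfl : gridPoint s t n n ≤ t)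
  omega

lemma encard_exhaustionTimes_le {C : ℕ} {a : ℝ≥0 → ℕ} {I : ℝ≥0 → Finset (Fin C)}
    (ha : Monotone a) (hI : IsLossPath a I) (s t : ℝ≥0) :
    (exhaustionTimes (fun v => (I v).card) s t).encard ≤ ((a t - a s : ℕ) : ℕ∞) :=
  (Set.encard_le_encard (t := {u | u ∈ Ioc s t ∧ HasPointAt a u}) fun _ hu =>
    have h := hI.mem_exhaustionTimes_iff.1 hu
    ⟨h.1, h.2.1⟩).trans (encard_hasPointAt_le ha s t)

/-! ### Estimates for the exponential and for Poisson increments. -/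

lemma sub_sq_le_one_sub_exp_neg {x : ℝ} (hx : 0 ≤ x) : x - x ^ 2 ≤ 1 - Real.exp (-x) := by
  have h1 : Real.exp (-x) ≤ 1 / (1 + x) := by
    rw [Real.exp_neg, ← one_div]
    exact one_div_le_one_div_of_le (by positivity) (by linarith [Real.add_one_le_exp x])
  have h2 : 1 / (1 + x) ≤ 1 - x + x ^ 2 := by
    rw [div_le_iff₀ (by positivity)]
    nlinarith [pow_nonneg hx 3]
  linarith

lemma one_sub_exp_neg_le (x : ℝ) : 1 - Real.exp (-x) ≤ x := by
  linarith [Real.add_one_le_exp (-x)]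

lemma one_sub_exp_neg_nonneg {x : ℝ} (hx : 0 ≤ x) : 0 ≤ 1 - Real.exp (-x) := by
  linarith [Real.exp_le_one_iff.2 (neg_nonpos.2 hx)]

lemma tendsto_nat_mul_one_sub_exp_neg_div {x : ℝ} (hx : 0 ≤ x) :
    Tendsto (fun n : ℕ => n * (1 - Real.exp (-(x / n)))) atTop (𝓝 x) := by
  have h1 : Tendsto (fun n : ℕ => x - x ^ 2 / n) atTop (𝓝 x) := by
    simpa using tendsto_const_nhds.sub (tendsto_const_div_atTop_nhds_zero_nat (x ^ 2))
  refine tendsto_of_tendsto_of_tendsto_of_le_of_le' h1 tendsto_const_nhds ?_ ?_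
  · filter_upwards [eventually_gt_atTop 0] with n hn
    have hn' : (0 : ℝ) < n := by exact_mod_cast hn
    have := mul_le_mul_of_nonneg_left
      (sub_sq_le_one_sub_exp_neg (div_nonneg hx hn'.le)) hn'.le
    refine le_trans (le_of_eq ?_) this
    field_simp
  · filter_upwards [eventually_gt_atTop 0] with n hn
    have hn' : (0 : ℝ) < n := by exact_mod_cast hn
    have := mul_le_mul_of_nonneg_left (one_sub_exp_neg_le (x / n)) hn'.le
    refine this.trans (le_of_eq ?_)
    field_simp

lemma lintegral_poissonMeasure (r : ℝ≥0) (f : ℕ → ℝ≥0∞) :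
    ∫⁻ n, f n ∂(poissonMeasure r) = ∑' n, poissonMeasure r {n} * f n := by
  rw [lintegral_countable']
  exact tsum_congr fun n => mul_comm _ _

/-- This recursion yields the mean when summed once and the second-order tail bound when used twice.
-/
lemma poissonMeasure_succ_mul (r : ℝ≥0) (n : ℕ) :
    poissonMeasure r {n + 1} * ((n + 1 : ℕ) : ℝ≥0∞) = r * poissonMeasure r {n} := by
  rw [poissonMeasure_singleton, poissonMeasure_singleton, ← ENNReal.ofReal_natCast,
    ← ENNReal.ofReal_coe_nnreal, ← ENNReal.ofReal_mul (by positivity),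
    ← ENNReal.ofReal_mul (by positivity)]
  congr 1
  rw [Nat.factorial_succ]
  push_cast
  field_simp
  ring

lemma tsum_poissonMeasure_singleton (r : ℝ≥0) : ∑' n, poissonMeasure r {n} = 1 := by
  have := lintegral_poissonMeasure r (fun _ => 1)
  simpa using this.symm

lemma lintegral_id_poissonMeasure (r : ℝ≥0) : ∫⁻ n, (n : ℝ≥0∞) ∂(poissonMeasure r) = r := by
  rw [lintegral_poissonMeasure, tsum_eq_zero_add' ENNReal.summable]
  simp only [poissonMeasure_succ_mul, ENNReal.tsum_mul_left, tsum_poissonMeasure_singleton]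
  simp

lemma lintegral_indicator_two_le_poissonMeasure (r : ℝ≥0) :
    ∫⁻ n, (Ici 2).indicator (fun n : ℕ => (n : ℝ≥0∞)) n ∂(poissonMeasure r) ≤ r ^ 2 := by
  rw [lintegral_poissonMeasure, tsum_eq_zero_add' ENNReal.summable,
    tsum_eq_zero_add' ENNReal.summable]
  have h : ∀ n : ℕ, poissonMeasure r {n + 1 + 1} *
      (Ici 2).indicator (fun n : ℕ => (n : ℝ≥0∞)) (n + 1 + 1) ≤ r ^ 2 * poissonMeasure r {n} := by
    intro n
    -- With `p n` for the weight of `n`: `(n + 2) p (n + 2) = r p (n + 1) ≤ r (n + 1) p (n + 1) = r²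
    -- p n`.
    rw [indicator_of_mem (by simp), poissonMeasure_succ_mul, pow_two, mul_assoc,
      ← poissonMeasure_succ_mul r n]
    gcongr
    exact le_mul_of_one_le_right' (by exact_mod_cast Nat.le_add_left 1 n)
  refine (add_le_add_right (add_le_add_right (ENNReal.tsum_le_tsum h) _) _).trans ?_
  rw [ENNReal.tsum_mul_left, tsum_poissonMeasure_singleton]
  simp

section Stream

variable {Ω : Type*} {m : MeasurableSpace Ω} {ℱ : Filtration ℝ≥0 m} {P : Measure Ω} {r : ℝ≥0}
  {N : ℝ≥0 → Ω → ℕ}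

lemma IsPoissonStream.measurable (hN : IsPoissonStream ℱ P r N) (t : ℝ≥0) : Measurable (N t) :=
  (hN.adapted t).mono (ℱ.le t) le_rfl

lemma IsPoissonStream.measurable_sub (hN : IsPoissonStream ℱ P r N) (s t : ℝ≥0) :
    Measurable fun ω => N t ω - N s ω :=
  (hN.measurable t).sub (hN.measurable s)

lemma IsPoissonStream.lintegral_sub (hN : IsPoissonStream ℱ P r N) {s t : ℝ≥0} (hst : s ≤ t)
    (f : ℕ → ℝ≥0∞) :
    ∫⁻ ω, f (N t ω - N s ω) ∂P = ∫⁻ n, f n ∂(poissonMeasure (r * (t - s))) := by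
  rw [← hN.law s t hst, lintegral_map (measurable_of_countable f) (hN.measurable_sub s t)]

lemma IsPoissonStream.measurableSet_increment_pos (hN : IsPoissonStream ℱ P r N) (s t : ℝ≥0) :
    MeasurableSet {ω | N s ω < N t ω} :=
  measurableSet_lt (hN.measurable s) (hN.measurable t)

lemma IsPoissonStream.measure_lt [IsProbabilityMeasure P] (hN : IsPoissonStream ℱ P r N)
    {s t : ℝ≥0} (hst : s ≤ t) :
    P {ω | N s ω < N t ω} = ENNReal.ofReal (1 - Real.exp (-(r * (t - s) : ℝ≥0))) := by
  have h : {ω | N s ω < N t ω} = ((fun ω => N t ω - N s ω) ⁻¹' {0})ᶜ := by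
    ext ω; simp [Nat.sub_eq_zero_iff_le]
  rw [h, measure_compl (hN.measurable_sub s t (measurableSet_singleton 0)) (measure_ne_top _ _),
    ← Measure.map_apply (hN.measurable_sub s t) (measurableSet_singleton 0), hN.law s t hst,
    poissonMeasure_singleton, measure_univ, ENNReal.ofReal_sub _ (by positivity)]
  simp

lemma IsPoissonStream.measure_inter_lt [IsProbabilityMeasure P] (hN : IsPoissonStream ℱ P r N)
    {s t : ℝ≥0} (hst : s ≤ t) {S : Set Ω} (hS : MeasurableSet[ℱ s] S) :
    P (S ∩ {ω | N s ω < N t ω}) =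
      P S * ENNReal.ofReal (1 - Real.exp (-(r * (t - s) : ℝ≥0))) := by
  rw [← hN.measure_lt hst, inter_comm, mul_comm]
  refine (Indep_iff _ _ _).1 (hN.indep s t hst) _ _ ⟨Ioi 0, trivial, ?_⟩ hS
  ext ω; simp

lemma IsPoissonStream.lintegral_excess_le (hN : IsPoissonStream ℱ P r N) {s t : ℝ≥0}
    (hst : s ≤ t) :
    ∫⁻ ω, (Ici 2).indicator (fun n : ℕ => (n : ℝ≥0∞)) (N t ω - N s ω) ∂P ≤
      ((r * (t - s) : ℝ≥0) : ℝ≥0∞) ^ 2 := by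
  rw [hN.lintegral_sub hst]
  exact lintegral_indicator_two_le_poissonMeasure _

lemma IsPoissonStream.measure_two_le (hN : IsPoissonStream ℱ P r N) {s t : ℝ≥0} (hst : s ≤ t) :
    P {ω | 2 ≤ N t ω - N s ω} ≤ ((r * (t - s) : ℝ≥0) : ℝ≥0∞) ^ 2 := by
  refine le_trans ?_ (hN.lintegral_excess_le hst)
  rw [← lintegral_indicator_one (measurableSet_le measurable_const (hN.measurable_sub s t))]
  refine lintegral_mono fun ω => ?_
  by_cases h : 2 ≤ N t ω - N s ω
  · rw [indicator_of_mem (by exact h), indicator_of_mem (by exact h)]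
    exact Nat.one_le_cast.2 (by omega : 1 ≤ N t ω - N s ω)
  · rw [indicator_of_notMem (by exact h)]
    exact zero_le

end Stream

/-! ### The mean number of exhaustions for an arbitrary service mechanism. -/

section Server

variable {Ω : Type*} {m : MeasurableSpace Ω} {ℱ : Filtration ℝ≥0 m} {P : Measure Ω}
  {C : ℕ} {lam : ℝ≥0} {A : ℝ≥0 → Ω → ℕ} {idle : ℝ≥0 → Ω → Finset (Fin C)}

lemma IsLossServer.measurableSet_idle (h : IsLossServer ℱ P C lam A idle) (t : ℝ≥0)
    (p : Finset (Fin C) → Prop) : MeasurableSet[ℱ t] {ω | p (idle t ω)} := by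
  have : {ω | p (idle t ω)} = ⋃ I ∈ {I | p I}, {ω | idle t ω = I} := by
    ext ω; simp
  rw [this]
  exact MeasurableSet.biUnion (Set.to_countable _) fun I _ => h.adapted t I

/-- The number of intervals of the uniform partition of `(s, t]` that start with one idle thread
and contain an arrival. -/
noncomputable def gridExhaustions (A : ℝ≥0 → Ω → ℕ) (idle : ℝ≥0 → Ω → Finset (Fin C))
    (s t : ℝ≥0) (n : ℕ) (ω : Ω) : ℝ≥0∞ :=
  ∑ i ∈ Finset.range n, ({ω | idleCount idle (gridPoint s t n i) ω = 1} ∩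
    {ω | A (gridPoint s t n i) ω < A (gridPoint s t n (i + 1)) ω}).indicator 1 ω

lemma gridExhaustions_eq (s t : ℝ≥0) (n : ℕ) (ω : Ω) : gridExhaustions A idle s t n ω =
    (((Finset.range n).filter fun i => (idle (gridPoint s t n i) ω).card = 1 ∧
        A (gridPoint s t n i) ω < A (gridPoint s t n (i + 1)) ω).card : ℝ≥0∞) := by
  rw [gridExhaustions, Finset.card_filter, Nat.cast_sum]
  refine Finset.sum_congr rfl fun i _ => ?_
  classical
  rw [indicator_apply]
  simp [idleCount]

lemma IsLossServer.measurable_gridExhaustions (h : IsLossServer ℱ P C lam A idle) (s t : ℝ≥0)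
    (n : ℕ) : Measurable (gridExhaustions A idle s t n) := by
  refine Finset.measurable_sum _ fun i _ => measurable_one.indicator (MeasurableSet.inter ?_ ?_)
  · exact ℱ.le _ _ (h.measurableSet_idle _ fun I => I.card = 1)
  · exact h.arrivals.measurableSet_increment_pos _ _

lemma IsLossServer.tendsto_gridExhaustions (h : IsLossServer ℱ P C lam A idle) {s t : ℝ≥0}
    (hst : s ≤ t) : ∀ᵐ ω ∂P, Tendsto (fun n => gridExhaustions A idle s t n ω) atTop
      (𝓝 ((exhaustionTimes (fun u => idleCount idle u ω) s t).encard : ℝ≥0∞)) := by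
  filter_upwards [h.path, h.arrivals.path] with ω hI ha
  refine tendsto_const_nhds.congr' ?_
  filter_upwards [hI.eventually_encard_exhaustionTimes ha hst] with n hn
  rw [gridExhaustions_eq, show (fun u => idleCount idle u ω) = fun v => (idle v ω).card from rfl,
    hn]
  simp

/-- The count is an almost sure limit of the measurable grid counts. -/
lemma IsLossServer.aemeasurable_exhaustions (h : IsLossServer ℱ P C lam A idle) {s t : ℝ≥0}
    (hst : s ≤ t) : AEMeasurable
      (fun ω => ((exhaustionTimes (fun u => idleCount idle u ω) s t).encard : ℝ≥0∞)) P :=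
  aemeasurable_of_tendsto_metrizable_ae atTop
    (fun n => (h.measurable_gridExhaustions s t n).aemeasurable) (h.tendsto_gridExhaustions hst)

lemma IsLossServer.meanExhaustions_add (h : IsLossServer ℱ P C lam A idle) {s t u : ℝ≥0}
    (hst : s ≤ t) (htu : t ≤ u) :
    meanExhaustions P (idleCount idle) s u =
      meanExhaustions P (idleCount idle) s t + meanExhaustions P (idleCount idle) t u := by
  simp only [meanExhaustions]
  rw [← lintegral_add_left' (h.aemeasurable_exhaustions hst)]
  refine lintegral_congr fun ω => ?_
  rw [← ENat.toENNReal_add, ← Set.encard_union_eq]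
  · congr 2
    ext v
    rw [mem_union]
    simp only [exhaustionTimes, mem_ofPred_eq]
    rw [← or_and_right, ← mem_union, Ioc_union_Ioc_eq_Ioc hst htu]
  · rw [Set.disjoint_left]
    exact fun v hv hv' => absurd hv.1.2 (not_le.2 hv'.1.1)

/-- Markov's inequality at level `1`. -/
lemma IsLossServer.measure_exhaustion_le (h : IsLossServer ℱ P C lam A idle) {s t : ℝ≥0}
    (hst : s ≤ t) :
    P {ω | (exhaustionTimes (fun u => idleCount idle u ω) s t).Nonempty} ≤
      meanExhaustions P (idleCount idle) s t := by
  have := mul_meas_ge_le_lintegral₀ (h.aemeasurable_exhaustions hst) 1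
  rw [one_mul] at this
  refine (measure_mono fun ω hω => ?_).trans this
  have h1 := Set.one_le_encard_iff_nonempty.2 hω
  exact_mod_cast ENat.toENNReal_le.2 h1

/-- With at most one arrival the count is at most the indicator of a jump. Otherwise it is at most
the number of arrivals, whose mean on the event of two or more arrivals is quadratically small. -/
lemma IsLossServer.meanExhaustions_le_measure_add (h : IsLossServer ℱ P C lam A idle)
    {s t : ℝ≥0} (hst : s ≤ t) :
    meanExhaustions P (idleCount idle) s t ≤
      P {ω | (exhaustionTimes (fun u => idleCount idle u ω) s t).Nonempty} +
        ((lam * (t - s) : ℝ≥0) : ℝ≥0∞) ^ 2 := by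
  have hm : Measurable fun ω =>
      (Ici 2).indicator (fun n : ℕ => (n : ℝ≥0∞)) (A t ω - A s ω) :=
    (measurable_of_countable fun k : ℕ => (Ici 2).indicator (fun n : ℕ => (n : ℝ≥0∞)) k).comp
      (h.arrivals.measurable_sub s t)
  refine le_trans ?_ (add_le_add (lintegral_indicator_one_le _)
    (h.arrivals.lintegral_excess_le hst))
  rw [← lintegral_add_right _ hm]
  refine lintegral_mono_ae ?_
  filter_upwards [h.path, h.arrivals.path] with ω hI ha
  have hle := encard_exhaustionTimes_le ha.mono hI s t
  change (exhaustionTimes (fun u => idleCount idle u ω) s t).encard ≤ _ at hle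
  have hle' := ENat.toENNReal_le.2 hle
  rw [ENat.toENNReal_coe] at hle'
  by_cases h2 : 2 ≤ A t ω - A s ω
  · rw [indicator_of_mem (show A t ω - A s ω ∈ Ici 2 from h2)]
    exact hle'.trans le_add_self
  · by_cases hne : (exhaustionTimes (fun u => idleCount idle u ω) s t).Nonempty
    · rw [indicator_of_mem (s := {ω | (exhaustionTimes _ s t).Nonempty}) (by exact hne)]
      refine le_trans (hle'.trans ?_) le_self_add
      exact Nat.cast_le_one.2 (by omega)
    · rw [Set.not_nonempty_iff_eq_empty.1 hne]
      simp

variable [IsProbabilityMeasure P]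

/-- The state at the left end of a cell belongs to the past, of which the arrivals in the cell are
independent; each term therefore factorises. -/
lemma IsLossServer.lintegral_gridExhaustions (h : IsLossServer ℱ P C lam A idle) (s t : ℝ≥0)
    (n : ℕ) : ∫⁻ ω, gridExhaustions A idle s t n ω ∂P =
      ∑ i ∈ Finset.range n, P {ω | idleCount idle (gridPoint s t n i) ω = 1} *
        ENNReal.ofReal (1 - Real.exp (-((lam * (t - s) : ℝ≥0) / n : ℝ))) := by
  have hm : ∀ i, MeasurableSet[ℱ (gridPoint s t n i)]
      {ω | idleCount idle (gridPoint s t n i) ω = 1} := fun i =>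
    h.measurableSet_idle _ fun I => I.card = 1
  simp only [gridExhaustions]
  rw [lintegral_finsetSum _ fun i _ => measurable_one.indicator
    ((ℱ.le _ _ (hm i)).inter (h.arrivals.measurableSet_increment_pos _ _))]
  refine Finset.sum_congr rfl fun i _ => ?_
  rw [lintegral_indicator_one
    ((ℱ.le _ _ (hm i)).inter (h.arrivals.measurableSet_increment_pos _ _)),
    h.arrivals.measure_inter_lt (gridPoint_mono s t n i.le_succ) (hm i), gridPoint_succ,
    add_tsub_cancel_left, mul_div_assoc' lam]
  push_cast
  rfl

lemma IsLossServer.tendsto_meanExhaustions (h : IsLossServer ℱ P C lam A idle) {s t : ℝ≥0}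
    (hst : s ≤ t) : Tendsto (fun n : ℕ =>
      ∑ i ∈ Finset.range n, P {ω | idleCount idle (gridPoint s t n i) ω = 1} *
        ENNReal.ofReal (1 - Real.exp (-((lam * (t - s) : ℝ≥0) / n : ℝ)))) atTop
      (𝓝 (meanExhaustions P (idleCount idle) s t)) := by
  simp_rw [← h.lintegral_gridExhaustions]
  refine tendsto_lintegral_of_dominated_convergence
    (fun ω => ((A t ω - A s ω : ℕ) : ℝ≥0∞)) (h.measurable_gridExhaustions s t) (fun n => ?_) ?_
    (h.tendsto_gridExhaustions hst)
  · filter_upwards [h.arrivals.path] with ω ha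
    rw [gridExhaustions_eq]
    exact_mod_cast card_grid_increments_le ha.mono hst n _
  · rw [h.arrivals.lintegral_sub hst (fun n => (n : ℝ≥0∞)), lintegral_id_poissonMeasure]
    exact ENNReal.coe_ne_top

lemma tendsto_grid_bound (x : ℝ≥0) {p : ℝ≥0∞} (hp : p ≠ ∞) :
    Tendsto (fun n : ℕ => ∑ _i ∈ Finset.range n, p *
      ENNReal.ofReal (1 - Real.exp (-((x : ℝ) / n)))) atTop (𝓝 (p * x)) := by
  have h1 := ENNReal.tendsto_ofReal (tendsto_nat_mul_one_sub_exp_neg_div x.coe_nonneg)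
  rw [ENNReal.ofReal_coe_nnreal] at h1
  refine (ENNReal.Tendsto.const_mul h1 (Or.inr hp)).congr fun n => ?_
  rw [Finset.sum_const, Finset.card_range, nsmul_eq_mul, ENNReal.ofReal_mul (by positivity),
    ENNReal.ofReal_natCast]
  ring

/-- Bounds on `Pr{c = 1}` over `[s, t]` bound the mean number of exhaustions in `(s, t]`. -/
lemma IsLossServer.le_meanExhaustions (h : IsLossServer ℱ P C lam A idle) {s t : ℝ≥0}
    (hst : s ≤ t) {p : ℝ≥0∞} (hp : p ≠ ∞)
    (hle : ∀ u ∈ Icc s t, p ≤ P {ω | idleCount idle u ω = 1}) :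
    p * (lam * (t - s) : ℝ≥0) ≤ meanExhaustions P (idleCount idle) s t :=
  le_of_tendsto_of_tendsto' (tendsto_grid_bound _ hp) (h.tendsto_meanExhaustions hst)
    fun n => Finset.sum_le_sum fun i hi => by
      gcongr
      exact hle _ ⟨le_gridPoint s t n i, gridPoint_le hst (Finset.mem_range.1 hi).le⟩

lemma IsLossServer.meanExhaustions_le (h : IsLossServer ℱ P C lam A idle) {s t : ℝ≥0}
    (hst : s ≤ t) {p : ℝ≥0∞} (hp : p ≠ ∞)
    (hle : ∀ u ∈ Icc s t, P {ω | idleCount idle u ω = 1} ≤ p) :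
    meanExhaustions P (idleCount idle) s t ≤ p * (lam * (t - s) : ℝ≥0) :=
  le_of_tendsto_of_tendsto' (h.tendsto_meanExhaustions hst) (tendsto_grid_bound _ hp)
    fun n => Finset.sum_le_sum fun i hi => by
      gcongr
      exact hle _ ⟨le_gridPoint s t n i, gridPoint_le hst (Finset.mem_range.1 hi).le⟩

/-- In steady state, the exhaustion rate is `λ Pr{c = 1}`. -/
lemma IsLossServer.isExhaustionRate (h : IsLossServer ℱ P C lam A idle)
    (hs : InSteadyState P (idleCount idle)) :
    IsExhaustionRate P (idleCount idle) (lam * P.real {ω | idleCount idle 0 ω = 1}) := by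
  set p := P {ω | idleCount idle 0 ω = 1} with hp
  have hp' : P.real {ω | idleCount idle 0 ω = 1} = p.toReal := rfl
  have hpt : p ≠ ∞ := measure_ne_top _ _
  rw [hp']
  have hmean : ∀ s t, s ≤ t →
      meanExhaustions P (idleCount idle) s t = p * (lam * (t - s) : ℝ≥0) := fun s t hst =>
    le_antisymm (h.meanExhaustions_le hst hpt fun u _ => (hs u 1).le)
      (h.le_meanExhaustions hst hpt fun u _ => (hs u 1).ge)
  constructor
  · intro t
    have hu : ∀ d : ℝ≥0,
        P.real {ω | (exhaustionTimes (fun u => idleCount idle u ω) t (t + d)).Nonempty} ≤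
          p.toReal * (lam * d) := fun d => by
      have := h.measure_exhaustion_le (le_self_add : t ≤ t + d)
      rw [hmean _ _ le_self_add, add_tsub_cancel_left] at this
      have := ENNReal.toReal_mono (by finiteness) this
      simpa [Measure.real] using this
    have hl : ∀ d : ℝ≥0, p.toReal * (lam * d) ≤
        P.real {ω | (exhaustionTimes (fun u => idleCount idle u ω) t (t + d)).Nonempty} +
          (lam * d) ^ 2 := fun d => by
      have := h.meanExhaustions_le_measure_add (le_self_add : t ≤ t + d)
      rw [hmean _ _ le_self_add, add_tsub_cancel_left] at this
      have := ENNReal.toReal_mono (by finiteness) this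
      rw [ENNReal.toReal_add (by finiteness) (by finiteness)] at this
      simpa [Measure.real] using this
    -- Division of `hl` and `hu` by `d` squeezes the quotient between `λ p - λ² d` and `λ p`.
    have hlim : Tendsto (fun d : ℝ≥0 => lam * p.toReal - (lam : ℝ) ^ 2 * (d : ℝ)) (𝓝[>] 0)
        (𝓝 (lam * p.toReal)) := by
      have : Continuous fun d : ℝ≥0 => lam * p.toReal - (lam : ℝ) ^ 2 * (d : ℝ) := by fun_prop
      have := (this.tendsto 0).mono_left (nhdsWithin_le_nhds (s := Ioi 0))
      simpa using this
    refine tendsto_of_tendsto_of_tendsto_of_le_of_le' hlim tendsto_const_nhds ?_ ?_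
    · filter_upwards [self_mem_nhdsWithin] with d hd
      have hd' : (0 : ℝ) < d := NNReal.coe_pos.2 hd
      rw [le_div_iff₀ hd']
      nlinarith [hl d]
    · filter_upwards [self_mem_nhdsWithin] with d hd
      have hd' : (0 : ℝ) < d := NNReal.coe_pos.2 hd
      rw [div_le_iff₀ hd']
      nlinarith [hu d]
  · intro s t hst
    rw [hmean s t hst, ← ENNReal.ofReal_toReal hpt, ← ENNReal.ofReal_coe_nnreal,
      ← ENNReal.ofReal_mul ENNReal.toReal_nonneg]
    push_cast [NNReal.coe_sub hst]
    congr 1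
    rw [ENNReal.toReal_ofReal ENNReal.toReal_nonneg]
    ring

/-- If `Pr{c(t) = 1}` converges, the time average of the number of exhaustions converges. -/
lemma IsLossServer.tendsto_meanExhaustions_div (h : IsLossServer ℱ P C lam A idle) {q : ℝ}
    (hq : Tendsto (fun t : ℝ≥0 => P.real {ω | idleCount idle t ω = 1}) atTop (𝓝 q)) :
    Tendsto (fun t : ℝ≥0 => meanExhaustions P (idleCount idle) 0 t / (t : ℝ≥0∞)) atTop
      (𝓝 (ENNReal.ofReal (lam * q))) := by
  have hfin : ∀ t, meanExhaustions P (idleCount idle) 0 t ≠ ∞ := fun t =>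
    ((h.meanExhaustions_le (zero_le (a := t)) ENNReal.one_ne_top fun u _ => prob_le_one).trans_lt
      (by finiteness)).ne
  set M : ℝ≥0 → ℝ := fun t => (meanExhaustions P (idleCount idle) 0 t).toReal with hM
  suffices hlim : Tendsto (fun t : ℝ≥0 => M t / t) atTop (𝓝 (lam * q)) by
    refine (ENNReal.tendsto_ofReal hlim).congr' ?_
    filter_upwards [eventually_gt_atTop 0] with t ht
    rw [ENNReal.ofReal_div_of_pos (NNReal.coe_pos.2 ht), ENNReal.ofReal_toReal (hfin t),
      ENNReal.ofReal_coe_nnreal]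
  -- After some time `T` the probability stays within `ε` of `q`, so the mean count over `(T, t]` is
  -- within `λ ε (t - T)` of `λ q (t - T)`.
  have hbound : ∀ ε : ℝ, 0 < ε → ∃ T : ℝ≥0, ∀ t, T ≤ t →
      |M t - M T - lam * q * (t - T)| ≤ lam * ε * (t - T) := by
    intro ε hε
    obtain ⟨T, hT⟩ := eventually_atTop.1 (Metric.tendsto_nhds.1 hq ε hε)
    refine ⟨T, fun t htT => ?_⟩
    have hadd := h.meanExhaustions_add (zero_le (a := T)) htT
    have hT' : meanExhaustions P (idleCount idle) T t ≠ ∞ := fun htop =>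
      hfin t (by rw [hadd, htop, add_top])
    have hMt : M t = M T + (meanExhaustions P (idleCount idle) T t).toReal := by
      simp only [hM]
      rw [hadd, ENNReal.toReal_add (hfin T) hT']
    have hp : ∀ u ∈ Icc T t, q - ε ≤ P.real {ω | idleCount idle u ω = 1} ∧
        P.real {ω | idleCount idle u ω = 1} ≤ q + ε := fun u hu => by
      have := hT u hu.1
      rw [Real.dist_eq, abs_lt] at this
      constructor <;> linarith
    have hqε : 0 ≤ q + ε := measureReal_nonneg.trans (hp T ⟨le_rfl, htT⟩).2
    have hlam : (0 : ℝ) ≤ lam * ((t : ℝ) - T) :=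
      mul_nonneg lam.coe_nonneg (sub_nonneg.2 (NNReal.coe_le_coe.2 htT))
    have h1 := ENNReal.toReal_mono (by finiteness)
      (h.meanExhaustions_le htT (p := ENNReal.ofReal (q + ε)) ENNReal.ofReal_ne_top fun u hu => by
        rw [← ofReal_measureReal]
        exact ENNReal.ofReal_le_ofReal (hp u hu).2)
    have h2 := ENNReal.toReal_mono hT'
      (h.le_meanExhaustions htT (p := ENNReal.ofReal (q - ε)) ENNReal.ofReal_ne_top fun u hu => by
        rw [← ofReal_measureReal]
        exact ENNReal.ofReal_le_ofReal (hp u hu).1)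
    rw [ENNReal.toReal_mul, ENNReal.toReal_ofReal hqε, ENNReal.coe_toReal, NNReal.coe_mul,
      NNReal.coe_sub htT] at h1
    rw [ENNReal.toReal_mul, ENNReal.coe_toReal, NNReal.coe_mul, NNReal.coe_sub htT] at h2
    -- `q - ε` may be negative; `ENNReal.ofReal` then truncates it to `0`, which only enlarges the
    -- left factor.
    have h3 : (q - ε) * (lam * ((t : ℝ) - T)) ≤
        (ENNReal.ofReal (q - ε)).toReal * (lam * ((t : ℝ) - T)) :=
      mul_le_mul_of_nonneg_right (by rw [ENNReal.toReal_ofReal']; exact le_max_left _ _) hlam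
    rw [abs_le, hMt]
    constructor <;> nlinarith
  rw [Metric.tendsto_nhds]
  intro ε hε
  -- The choice makes `λ` times the tolerance at most `ε / 2`; the `+ 1` keeps the denominator
  -- positive when `λ = 0`. The other `ε / 2` absorbs the fixed contribution of `(0, T]`.
  obtain ⟨T, hT⟩ := hbound (ε / (2 * (lam + 1))) (by positivity)
  have hc : Tendsto (fun t : ℝ≥0 => (M T + |lam * q * T|) / (t : ℝ)) atTop (𝓝 0) :=
    tendsto_const_nhds.div_atTop (NNReal.tendsto_coe_atTop.2 tendsto_id)
  filter_upwards [eventually_ge_atTop T, eventually_gt_atTop 0,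
    hc.eventually_lt_const (half_pos hε)] with t ht ht0 hct
  have ht0' : (0 : ℝ) < t := NNReal.coe_pos.2 ht0
  have hMT : 0 ≤ M T := ENNReal.toReal_nonneg
  have h1 := hT t ht
  have h2 : (lam : ℝ) * (ε / (2 * (lam + 1))) * (t - T) ≤ ε / 2 * t := by
    have e1 : (lam : ℝ) * (ε / (2 * (lam + 1))) ≤ ε / 2 := by
      rw [← mul_div_assoc, div_le_div_iff₀ (by positivity) (by positivity)]
      nlinarith [lam.coe_nonneg]
    have e2 : (t : ℝ) - T ≤ t := by linarith [T.coe_nonneg]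
    have e3 : (0 : ℝ) ≤ t - T := sub_nonneg.2 (NNReal.coe_le_coe.2 ht)
    exact mul_le_mul e1 e2 e3 (by positivity)
  rw [div_lt_iff₀ ht0'] at hct
  rw [Real.dist_eq, div_sub' ht0'.ne', abs_div, abs_of_pos ht0', div_lt_iff₀ ht0']
  have h4 := le_abs_self (lam * q * (T : ℝ))
  have h5 := neg_abs_le (lam * q * (T : ℝ))
  rw [abs_le] at h1
  rw [abs_lt]
  constructor <;> nlinarith [h1.1, h1.2]

end Server

/-! ### The forward equation under exponential service. -/

lemma IsPoissonStream.measureReal_lt_le {Ω : Type*} {m : MeasurableSpace Ω}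
    {ℱ : Filtration ℝ≥0 m} {P : Measure Ω} [IsProbabilityMeasure P] {r R : ℝ≥0}
    {N : ℝ≥0 → Ω → ℕ} (hN : IsPoissonStream ℱ P r N) (hr : r ≤ R) {s t : ℝ≥0} (hst : s ≤ t) :
    P.real {ω | N s ω < N t ω} ≤ R * (t - s : ℝ≥0) := by
  rw [Measure.real, hN.measure_lt hst,
    ENNReal.toReal_ofReal (one_sub_exp_neg_nonneg (NNReal.coe_nonneg _))]
  refine (one_sub_exp_neg_le _).trans ?_
  rw [NNReal.coe_mul]
  gcongr

lemma IsPoissonStream.measureReal_two_le {Ω : Type*} {m : MeasurableSpace Ω}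
    {ℱ : Filtration ℝ≥0 m} {P : Measure Ω} {r R : ℝ≥0}
    {N : ℝ≥0 → Ω → ℕ} (hN : IsPoissonStream ℱ P r N) (hr : r ≤ R) {s t : ℝ≥0} (hst : s ≤ t) :
    P.real {ω | 2 ≤ N t ω - N s ω} ≤ (R * (t - s : ℝ≥0)) ^ 2 := by
  have h1 := ENNReal.toReal_mono (by finiteness) (hN.measure_two_le hst)
  refine h1.trans ?_
  rw [ENNReal.toReal_pow, ENNReal.coe_toReal, NNReal.coe_mul]
  gcongr

lemma IsPoissonStream.measureReal_inter_lt {Ω : Type*} {m : MeasurableSpace Ω}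
    {ℱ : Filtration ℝ≥0 m} {P : Measure Ω} [IsProbabilityMeasure P] {r : ℝ≥0}
    {N : ℝ≥0 → Ω → ℕ} (hN : IsPoissonStream ℱ P r N) {s t : ℝ≥0} (hst : s ≤ t) {S : Set Ω}
    (hS : MeasurableSet[ℱ s] S) :
    P.real (S ∩ {ω | N s ω < N t ω}) =
      P.real S * (1 - Real.exp (-(r * (t - s : ℝ≥0)))) := by
  rw [Measure.real, hN.measure_inter_lt hst hS, ENNReal.toReal_mul,
    ENNReal.toReal_ofReal (one_sub_exp_neg_nonneg (NNReal.coe_nonneg _)), NNReal.coe_mul]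
  rfl

section Clocks

variable {Ω : Type*} {m : MeasurableSpace Ω} {ℱ : Filtration ℝ≥0 m} {P : Measure Ω}
  {C : ℕ} {lam mu : ℝ≥0} {A : ℝ≥0 → Ω → ℕ} {idle : ℝ≥0 → Ω → Finset (Fin C)}
  {D : Fin C → ℝ≥0 → Ω → ℕ}

/-- The arrival stream together with the service clocks. -/
def allStreams (A : ℝ≥0 → Ω → ℕ) (D : Fin C → ℝ≥0 → Ω → ℕ) (j : Option (Fin C)) :
    ℝ≥0 → Ω → ℕ := j.elim A D

/-- At least two points of the arrival stream and the service clocks fall into `(s, t]`. -/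
def manyPoints (A : ℝ≥0 → Ω → ℕ) (D : Fin C → ℝ≥0 → Ω → ℕ) (s t : ℝ≥0) : Set Ω :=
  ⋃ p : Option (Fin C) × Option (Fin C), if p.1 = p.2 then
      {ω | 2 ≤ allStreams A D p.1 t ω - allStreams A D p.1 s ω}
    else {ω | allStreams A D p.1 s ω < allStreams A D p.1 t ω} ∩
      {ω | allStreams A D p.2 s ω < allStreams A D p.2 t ω}

lemma HasServiceRate.exists_isPoissonStream (hS : HasServiceRate ℱ P C mu A D idle)
    (h : IsLossServer ℱ P C lam A idle) (j : Option (Fin C)) :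
    ∃ r ≤ lam + mu, IsPoissonStream ℱ P r (allStreams A D j) := by
  cases j with
  | none => exact ⟨lam, le_self_add, h.arrivals⟩
  | some i => exact ⟨mu, le_add_self, hS.clocks i⟩

lemma HasServiceRate.measurableSet_manyPoints (hS : HasServiceRate ℱ P C mu A D idle)
    (h : IsLossServer ℱ P C lam A idle) (s t : ℝ≥0) : MeasurableSet (manyPoints A D s t) := by
  refine MeasurableSet.iUnion fun p => ?_
  obtain ⟨_, -, h1⟩ := hS.exists_isPoissonStream h p.1
  obtain ⟨_, -, h2⟩ := hS.exists_isPoissonStream h p.2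
  split_ifs
  · exact measurableSet_le measurable_const (h1.measurable_sub s t)
  · exact (h1.measurableSet_increment_pos s t).inter (h2.measurableSet_increment_pos s t)

/-- Union bound over the `(C + 1)²` pairs of streams: a repeated stream uses the Poisson tail, two
distinct streams use their independence. -/
lemma HasServiceRate.measureReal_manyPoints_le [IsProbabilityMeasure P]
    (hS : HasServiceRate ℱ P C mu A D idle)
    (h : IsLossServer ℱ P C lam A idle) {s t : ℝ≥0} (hst : s ≤ t) :
    P.real (manyPoints A D s t) ≤ ((C : ℝ) + 1) ^ 2 * ((lam + mu) * (t - s : ℝ≥0)) ^ 2 := by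
  refine (measureReal_iUnion_fintype_le _).trans ?_
  have hcard : ∑ _p : Option (Fin C) × Option (Fin C), (((lam : ℝ) + mu) * (t - s : ℝ≥0)) ^ 2 =
      ((C : ℝ) + 1) ^ 2 * ((lam + mu) * (t - s : ℝ≥0)) ^ 2 := by
    simp [Finset.sum_const, Finset.card_univ, pow_two]
  rw [← hcard]
  refine Finset.sum_le_sum fun p _ => ?_
  obtain ⟨r, hr, h1⟩ := hS.exists_isPoissonStream h p.1
  obtain ⟨r', hr', h2⟩ := hS.exists_isPoissonStream h p.2
  split_ifs with hp
  · exact_mod_cast h1.measureReal_two_le hr hst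
  · have hind := (hS.indep_clocks s t hst).indepFun hp
    have heq := hind.measure_inter_preimage_eq_mul (Ioi 0) (Ioi 0) trivial trivial
    have hset : ∀ j : Option (Fin C), (fun ω => j.elim (A t ω - A s ω)
        (fun i => D i t ω - D i s ω)) ⁻¹' Ioi 0 =
        {ω | allStreams A D j s ω < allStreams A D j t ω} := by
      intro j
      ext ω
      cases j <;> simp [allStreams]
    rw [hset, hset] at heq
    rw [Measure.real, heq, ENNReal.toReal_mul, pow_two]
    exact mul_le_mul (by exact_mod_cast h1.measureReal_lt_le hr hst)
      (by exact_mod_cast h2.measureReal_lt_le hr' hst) measureReal_nonneg (by positivity)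

/-- If at most one point falls into `(s, t]`, the change of `c` is explained by that point. -/
lemma HasServiceRate.indicator_idleCount_le_eq (hS : HasServiceRate ℱ P C mu A D idle)
    (h : IsLossServer ℱ P C lam A idle) {s t : ℝ≥0} (hst : s ≤ t) (k : ℕ) :
    ∀ᵐ ω ∂P, ω ∉ manyPoints A D s t →
      ({ω | idleCount idle t ω ≤ k}.indicator 1 ω : ℝ) =
        {ω | idleCount idle s ω ≤ k}.indicator 1 ω +
        ({ω | idleCount idle s ω = k + 1} ∩ {ω | A s ω < A t ω}).indicator 1 ω -
        ∑ i, ({ω | idleCount idle s ω = k ∧ i ∉ idle s ω} ∩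
          {ω | D i s ω < D i t ω}).indicator 1 ω := by
  have hd := ae_all_iff.2 fun i => (hS.clocks i).path
  filter_upwards [h.path, h.arrivals.path, hS.completion, hd] with ω hI ha hc hd hω
  classical
  simp only [manyPoints, mem_iUnion, not_exists, Prod.forall] at hω
  have h1 : ∀ j, allStreams A D j t ω ≤ allStreams A D j s ω + 1 := by
    intro j
    have := hω j j
    rw [if_pos rfl, mem_ofPred_eq] at this
    omega
  have h2 : ∀ j j', j ≠ j' → allStreams A D j s ω < allStreams A D j t ω →
      allStreams A D j' t ω ≤ allStreams A D j' s ω := by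
    intro j j' hj hlt
    have := hω j j'
    rw [if_neg hj] at this
    by_contra hcon
    exact this ⟨hlt, not_le.1 hcon⟩
  have ham : A s ω ≤ A t ω := ha.mono hst
  have hdm : ∀ i, D i s ω ≤ D i t ω := fun i => (hd i).mono hst
  simp only [indicator_apply, mem_inter_iff, mem_ofPred_eq, Pi.one_apply, idleCount]
  by_cases hA : A s ω < A t ω
  · have hD0 : ∀ i, D i t ω = D i s ω := fun i =>
      le_antisymm (h2 none (some i) (by simp) hA) (hdm i)
    have hcard := hI.card_of_one_arrival hc ha hd
      (le_antisymm (h1 none) hA) hD0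
    rw [Finset.sum_eq_zero fun i _ => by simp [hD0 i], sub_zero, hcard]
    split_ifs <;> first | omega | simp
  · have hA0 : A t ω = A s ω := le_antisymm (not_lt.1 hA) ham
    simp only [hA, and_false, if_false, add_zero]
    by_cases hex : ∃ i, D i s ω < D i t ω
    · obtain ⟨i, hi⟩ := hex
      have hD0 : ∀ j ≠ i, D j t ω = D j s ω := fun j hj =>
        le_antisymm (h2 (some i) (some j) (by simpa using hj.symm) hi) (hdm j)
      have hcard := hI.eq_insert_of_one_completion hc ha hd i hA0
        (le_antisymm (h1 (some i)) hi) hD0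
      rw [Finset.sum_eq_single i (fun j _ hj => by simp [hD0 j hj]) (by simp), hcard]
      by_cases hmem : i ∈ idle s ω
      · simp [hmem]
      · rw [Finset.card_insert_of_notMem hmem]
        simp only [hmem, hi, not_false_eq_true, and_true]
        split_ifs <;> first | omega | simp
    · push Not at hex
      have hD0 : ∀ i, D i t ω = D i s ω := fun i => le_antisymm (hex i) (hdm i)
      rw [Finset.sum_eq_zero fun i _ => by simp [hD0 i], sub_zero,
        hI.eq_of_no_points hc ha hd hst hA0 hD0]

variable [IsProbabilityMeasure P]

/-- On `{c = k}` exactly `C - k` threads are busy, whichever they are. Hence the equation for `c`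
closes although the choice of the occupied thread is arbitrary. -/
lemma IsLossServer.sum_measureReal_busy (h : IsLossServer ℱ P C lam A idle) (s : ℝ≥0) (k : ℕ) :
    ∑ i, P.real {ω | idleCount idle s ω = k ∧ i ∉ idle s ω} =
      ((C : ℝ) - k) * P.real {ω | idleCount idle s ω = k} := by
  have hm : ∀ i, MeasurableSet {ω | idleCount idle s ω = k ∧ i ∉ idle s ω} := fun i =>
    ℱ.le _ _ (h.measurableSet_idle s fun I => I.card = k ∧ i ∉ I)
  have hm' : MeasurableSet {ω | idleCount idle s ω = k} :=
    ℱ.le _ _ (h.measurableSet_idle s fun I => I.card = k)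
  simp_rw [← integral_indicator_one (hm _), ← integral_indicator_one hm']
  have hint : ∀ i, Integrable
      ({ω | idleCount idle s ω = k ∧ i ∉ idle s ω}.indicator (1 : Ω → ℝ)) P :=
    fun i => (integrable_const (1 : ℝ)).indicator (hm i)
  rw [← integral_finsetSum _ fun i _ => hint i,
    ← integral_const_mul]
  congr 1
  ext ω
  classical
  simp only [indicator_apply, mem_ofPred_eq, Pi.one_apply]
  by_cases hk : idleCount idle s ω = k
  · have hcard : (Finset.univ.filter fun i => i ∉ idle s ω).card = C - k := by
      rw [← hk, idleCount, ← Finset.compl_filter, Finset.filter_mem_eq_inter, Finset.univ_inter,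
        Finset.card_compl, Fintype.card_fin]
    have hle : k ≤ C := by
      rw [← hk]
      exact (Finset.card_le_univ _).trans_eq (Fintype.card_fin C)
    simp only [hk, true_and, if_true, mul_one]
    rw [Finset.sum_boole, hcard, Nat.cast_sub hle]
  · simp [hk]

/-- The forward equation of the distribution function of `c`, with an error term. -/
lemma HasServiceRate.abs_measureReal_idleCount_le_sub_le (hS : HasServiceRate ℱ P C mu A D idle)
    (h : IsLossServer ℱ P C lam A idle) {s t : ℝ≥0} (hst : s ≤ t) (k : ℕ) :
    |P.real {ω | idleCount idle t ω ≤ k} - P.real {ω | idleCount idle s ω ≤ k} -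
        P.real {ω | idleCount idle s ω = k + 1} * (1 - Real.exp (-(lam * (t - s : ℝ≥0)))) +
        ((C : ℝ) - k) * P.real {ω | idleCount idle s ω = k} *
          (1 - Real.exp (-(mu * (t - s : ℝ≥0))))| ≤
      (C + 2) * (((C : ℝ) + 1) ^ 2 * ((lam + mu) * (t - s : ℝ≥0)) ^ 2) := by
  have hm : ∀ u (p : Finset (Fin C) → Prop), MeasurableSet {ω | p (idle u ω)} := fun u p =>
    ℱ.le _ _ (h.measurableSet_idle u p)
  have hmt := hm t fun I => I.card ≤ k
  have hms := hm s fun I => I.card ≤ k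
  have hmE := (hm s fun I => I.card = k + 1).inter (h.arrivals.measurableSet_increment_pos s t)
  have hmF := fun i => (hm s fun I => I.card = k ∧ i ∉ I).inter
    ((hS.clocks i).measurableSet_increment_pos s t)
  have hmB := hS.measurableSet_manyPoints h s t
  have hint : ∀ {S : Set Ω}, MeasurableSet S → Integrable (S.indicator (1 : Ω → ℝ)) P :=
    fun hS => (integrable_const (1 : ℝ)).indicator hS
  have hE := h.arrivals.measureReal_inter_lt hst (h.measurableSet_idle s fun I => I.card = k + 1)
  have hF := fun i => (hS.clocks i).measureReal_inter_lt hst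
    (h.measurableSet_idle s fun I => I.card = k ∧ i ∉ I)
  rw [← h.sum_measureReal_busy, Finset.sum_mul]
  simp only [idleCount]
  rw [← hE, Finset.sum_congr rfl fun i _ => (hF i).symm]
  refine le_trans ?_ (mul_le_mul_of_nonneg_left (hS.measureReal_manyPoints_le h hst)
    (by positivity))
  rw [← integral_indicator_one hmt, ← integral_indicator_one hms, ← integral_indicator_one hmE,
    Finset.sum_congr rfl fun i _ => (integral_indicator_one (hmF i)).symm,
    ← integral_indicator_one hmB, ← integral_finsetSum _ fun i _ => hint (hmF i),
    ← integral_sub' (hint hmt) (hint hms), ← integral_sub' ((hint hmt).sub (hint hms)) (hint hmE),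
    ← integral_add (((hint hmt).sub (hint hms)).sub (hint hmE))
      (integrable_finsetSum _ fun i _ => hint (hmF i)), ← integral_const_mul,
    ← Real.norm_eq_abs]
  -- The integrand vanishes almost surely off `manyPoints`. On it, the integrand combines `C + 3`
  -- indicators and lies between `-2` and `C + 1`.
  refine norm_integral_le_of_norm_le ((hint hmB).const_mul _) ?_
  filter_upwards [hS.indicator_idleCount_le_eq h hst k] with ω hω
  simp only [Pi.sub_apply]
  by_cases hB : ω ∈ manyPoints A D s t
  · rw [indicator_of_mem hB, Pi.one_apply, mul_one, Real.norm_eq_abs]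
    have h01 : ∀ S : Set Ω, (0 : ℝ) ≤ S.indicator 1 ω ∧ S.indicator (1 : Ω → ℝ) ω ≤ 1 := fun S =>
      ⟨indicator_nonneg (fun _ _ => zero_le_one) ω, indicator_le_self' (fun _ _ => zero_le_one) ω⟩
    have hs0 := Finset.sum_nonneg fun i (_ : i ∈ Finset.univ) =>
      (h01 ({ω | (idle s ω).card = k ∧ i ∉ idle s ω} ∩ {ω | D i s ω < D i t ω})).1
    have hs1 := Finset.sum_le_card_nsmul Finset.univ _ 1 fun i (_ : i ∈ Finset.univ) =>
      (h01 ({ω | (idle s ω).card = k ∧ i ∉ idle s ω} ∩ {ω | D i s ω < D i t ω})).2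
    rw [Finset.card_univ, Fintype.card_fin, nsmul_eq_mul, mul_one] at hs1
    have a1 := h01 {ω | (idle t ω).card ≤ k}
    have a2 := h01 {ω | (idle s ω).card ≤ k}
    have a3 := h01 ({ω | (idle s ω).card = k + 1} ∩ {ω | A s ω < A t ω})
    rw [abs_le]
    constructor <;> linarith [a1.1, a1.2, a2.1, a2.2, a3.1, a3.2, (Nat.cast_nonneg C : (0:ℝ) ≤ C)]
  · have := hω hB
    simp only [idleCount] at this
    rw [this, indicator_of_notMem hB, mul_zero, norm_le_zero_iff]
    ring

/-- The forward equation of the distribution function of `c`. -/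
lemma HasServiceRate.exists_forward_bound (hS : HasServiceRate ℱ P C mu A D idle)
    (h : IsLossServer ℱ P C lam A idle) : ∃ M : ℝ, 0 ≤ M ∧ ∀ s d : ℝ≥0, ∀ k < C,
    |P.real {ω | idleCount idle (s + d) ω ≤ k} - P.real {ω | idleCount idle s ω ≤ k} -
      d * (lam * P.real {ω | idleCount idle s ω = k + 1} -
        ((C : ℝ) - k) * mu * P.real {ω | idleCount idle s ω = k})| ≤ M * (d : ℝ) ^ 2 := by
  -- The summands `λ²` and `C μ²` pay for replacing `1 - exp (-x)` by `x`, at a cost of at most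
  -- `x²`.
  refine ⟨(C + 2) * (((C : ℝ) + 1) ^ 2 * (lam + mu) ^ 2) + lam ^ 2 + C * mu ^ 2, by positivity,
    fun s d k hk => ?_⟩
  have h1 := hS.abs_measureReal_idleCount_le_sub_le h (le_self_add : s ≤ s + d) k
  rw [add_tsub_cancel_left] at h1
  have hx : ∀ x : ℝ≥0, ∀ q : ℝ, 0 ≤ q → q ≤ 1 →
      0 ≤ q * (x * d - (1 - Real.exp (-(x * d : ℝ)))) ∧
      q * (x * d - (1 - Real.exp (-(x * d : ℝ)))) ≤ (x : ℝ) ^ 2 * (d : ℝ) ^ 2 := by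
    intro x q hq0 hq1
    have hxd : (0 : ℝ) ≤ x * d := by positivity
    have e1 := sub_sq_le_one_sub_exp_neg hxd
    have e2 := one_sub_exp_neg_le ((x : ℝ) * d)
    refine ⟨mul_nonneg hq0 (by linarith), ?_⟩
    rw [← mul_pow]
    exact (mul_le_of_le_one_left (by linarith) hq1).trans (by linarith)
  have h2 := hx lam _ (measureReal_nonneg (μ := P) (s := {ω | idleCount idle s ω = k + 1}))
    measureReal_le_one
  have h3 := hx mu _ (measureReal_nonneg (μ := P) (s := {ω | idleCount idle s ω = k}))
    measureReal_le_one
  have hCk : (0 : ℝ) ≤ (C : ℝ) - k := by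
    rw [sub_nonneg]; exact_mod_cast hk.le
  have h4 := mul_nonneg hCk h3.1
  have h5 : ((C : ℝ) - k) * _ ≤ C * (mu ^ 2 * (d : ℝ) ^ 2) :=
    mul_le_mul (sub_le_self _ (Nat.cast_nonneg k)) h3.2 h3.1 (Nat.cast_nonneg C)
  rw [abs_le] at h1 ⊢
  constructor <;> nlinarith [h1.1, h1.2, h2.1, h2.2]

end Clocks

/-! ### Contraction of the birth–death dynamics. -/

/-- One step of an approximate birth–death dynamics, seen on the differences of distribution
functions, contracts the sum of absolute values. -/
lemma sum_abs_birth_death_step_le {C : ℕ} {l m h M : ℝ} (hl : 0 ≤ l) (hm : 0 ≤ m) (hh : 0 ≤ h)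
    (hsmall : h * (l + C * m) ≤ 1) {e e' : ℕ → ℝ} (e0 : e 0 = 0) (eC : e (C + 1) = 0)
    (hstep : ∀ k < C, |e' (k + 1) - e (k + 1) -
      h * (l * (e (k + 2) - e (k + 1)) - ((C : ℝ) - k) * m * (e (k + 1) - e k))| ≤ M * h ^ 2) :
    ∑ k ∈ Finset.range C, |e' (k + 1)| ≤
      (1 - h * m) * ∑ k ∈ Finset.range C, |e (k + 1)| + C * M * h ^ 2 := by
  have hk : ∀ k ∈ Finset.range C, |e' (k + 1)| ≤
      (1 - h * l - h * m * ((C : ℝ) - k)) * |e (k + 1)| + h * l * |e (k + 2)| +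
        h * m * (((C : ℝ) - k) * |e k|) + M * h ^ 2 := by
    intro k hk
    have hkC : (k : ℝ) ≤ C := by exact_mod_cast (Finset.mem_range.1 hk).le
    -- The small step keeps the diagonal coefficient nonnegative, so no sign is lost in the triangle
    -- inequality.
    have hc : 0 ≤ 1 - h * l - h * m * ((C : ℝ) - k) := by
      have : h * m * ((C : ℝ) - k) ≤ h * m * C := by
        gcongr
        exact sub_le_self _ (Nat.cast_nonneg k)
      linarith
    have hb : 0 ≤ h * m * ((C : ℝ) - k) := mul_nonneg (by positivity) (by linarith)
    have heq : e' (k + 1) = (1 - h * l - h * m * ((C : ℝ) - k)) * e (k + 1) +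
        h * l * e (k + 2) + h * m * ((C : ℝ) - k) * e k + (e' (k + 1) - e (k + 1) -
      h * (l * (e (k + 2) - e (k + 1)) - ((C : ℝ) - k) * m * (e (k + 1) - e k))) := by ring
    rw [heq]
    refine (abs_add_le _ _).trans (add_le_add ?_ (hstep k (Finset.mem_range.1 hk)))
    refine (abs_add_three _ _ _).trans (le_of_eq ?_)
    rw [abs_mul, abs_mul (h * l), abs_mul (h * m * _), abs_of_nonneg hc, abs_of_nonneg hb,
      abs_of_nonneg (mul_nonneg hh hl), mul_assoc (h * m)]
  refine (Finset.sum_le_sum hk).trans ?_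
  have s1 : ∑ k ∈ Finset.range C, |e (k + 2)| ≤ ∑ k ∈ Finset.range C, |e (k + 1)| := by
    have h1 := Finset.sum_range_succ (fun k => |e (k + 1)|) C
    have h2 := Finset.sum_range_succ' (fun k => |e (k + 1)|) C
    rw [eC, abs_zero, add_zero] at h1
    rw [← h1, h2]
    exact le_add_of_nonneg_right (abs_nonneg _)
  -- Shifting the index lowers the weight `C - k` by one. The weighted sums then cancel, and the
  -- leftover unweighted sum is the source of the contraction rate `m`.
  have s2 : ∑ k ∈ Finset.range C, ((C : ℝ) - k) * |e k| =
      ∑ k ∈ Finset.range C, ((C : ℝ) - k) * |e (k + 1)| - ∑ k ∈ Finset.range C, |e (k + 1)| := by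
    have h1 := Finset.sum_range_succ (fun k : ℕ => ((C : ℝ) - k) * |e k|) C
    have h2 := Finset.sum_range_succ' (fun k : ℕ => ((C : ℝ) - k) * |e k|) C
    rw [sub_self, zero_mul, add_zero] at h1
    rw [e0, abs_zero, mul_zero, add_zero] at h2
    rw [← h1, h2, ← Finset.sum_sub_distrib]
    refine Finset.sum_congr rfl fun k _ => ?_
    push_cast
    ring
  have hexp : ∑ k ∈ Finset.range C, ((1 - h * l - h * m * ((C : ℝ) - k)) * |e (k + 1)| +
        h * l * |e (k + 2)| + h * m * (((C : ℝ) - k) * |e k|) + M * h ^ 2) =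
      (1 - h * l) * ∑ k ∈ Finset.range C, |e (k + 1)| -
        h * m * ∑ k ∈ Finset.range C, ((C : ℝ) - k) * |e (k + 1)| +
        h * l * ∑ k ∈ Finset.range C, |e (k + 2)| +
        h * m * ∑ k ∈ Finset.range C, ((C : ℝ) - k) * |e k| + C * (M * h ^ 2) := by
    have h3 : ∑ k ∈ Finset.range C, (1 - h * l - h * m * ((C : ℝ) - k)) * |e (k + 1)| =
        (1 - h * l) * ∑ k ∈ Finset.range C, |e (k + 1)| -
          h * m * ∑ k ∈ Finset.range C, ((C : ℝ) - k) * |e (k + 1)| := by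
      rw [Finset.mul_sum, Finset.mul_sum, ← Finset.sum_sub_distrib]
      exact Finset.sum_congr rfl fun k _ => by ring
    rw [Finset.sum_add_distrib, Finset.sum_add_distrib, Finset.sum_add_distrib, Finset.sum_const,
      Finset.card_range, nsmul_eq_mul, ← Finset.mul_sum, ← Finset.mul_sum, h3]
  rw [hexp, s2]
  have := mul_le_mul_of_nonneg_left s1 (mul_nonneg hh hl)
  linarith

/-- Take `n` steps of length `t / n`: the factors tend to `exp (-m t)`, while the accumulated error
is at most `M t² / n`. No regularity of `φ` is needed. -/
lemma le_exp_mul_of_step {φ : ℝ≥0 → ℝ} {m M κ : ℝ} (hm : 0 ≤ m) (hmκ : m ≤ κ)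
    (hM : 0 ≤ M) (hstep : ∀ t d : ℝ≥0, d * κ ≤ 1 → φ (t + d) ≤ (1 - d * m) * φ t + M * (d : ℝ) ^ 2)
    (t : ℝ≥0) : φ t ≤ Real.exp (-(m * t)) * φ 0 := by
  have hiter : ∀ d : ℝ≥0, d * κ ≤ 1 → ∀ n : ℕ,
      φ (n * d) ≤ (1 - d * m) ^ n * φ 0 + n * (M * (d : ℝ) ^ 2) := by
    intro d hd n
    have hdm0 : (0 : ℝ) ≤ d * m := by positivity
    have hdm : (d : ℝ) * m ≤ 1 := (mul_le_mul_of_nonneg_left hmκ d.coe_nonneg).trans hd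
    induction n with
    | zero => simp
    | succ n ih =>
      have h1 := hstep (n * d) d hd
      have h2 := mul_le_mul_of_nonneg_left ih (sub_nonneg.2 hdm)
      have h3 : (1 - d * m) * (n * (M * (d : ℝ) ^ 2)) ≤ n * (M * (d : ℝ) ^ 2) :=
        mul_le_of_le_one_left (by positivity) (by linarith)
      have h4 : ((n + 1 : ℕ) : ℝ≥0) * d = n * d + d := by push_cast; ring
      rw [h4, pow_succ]
      push_cast
      linarith
  have hlim : Tendsto (fun n : ℕ => (1 + -(m * t) / n) ^ n * φ 0 + M * (t : ℝ) ^ 2 / n) atTop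
      (𝓝 (Real.exp (-(m * t)) * φ 0 + 0)) :=
    ((Real.tendsto_one_add_div_pow_exp (-(m * t))).mul_const _).add
      (tendsto_const_div_atTop_nhds_zero_nat _)
  rw [add_zero] at hlim
  refine ge_of_tendsto hlim ?_
  filter_upwards [eventually_gt_atTop 0, eventually_ge_atTop ⌈(t : ℝ) * κ⌉₊] with n hn hn'
  have hn0 : (0 : ℝ) < n := by exact_mod_cast hn
  have hd : ((t / n : ℝ≥0) : ℝ) * κ ≤ 1 := by
    rw [NNReal.coe_div, NNReal.coe_natCast, div_mul_eq_mul_div, div_le_one hn0]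
    exact Nat.ceil_le.1 hn'
  have := hiter (t / n) hd n
  rw [mul_div_cancel₀ _ (by exact_mod_cast hn.ne' : (n : ℝ≥0) ≠ 0)] at this
  refine this.trans (le_of_eq ?_)
  rw [NNReal.coe_div, NNReal.coe_natCast]
  congr 1
  · congr 2
    ring
  · field_simp

/-! ### The Erlang weights. -/

/-- The stationary probability that `k` of the `C` threads are idle. -/
noncomputable def stationaryIdle (ρ : ℝ) (C k : ℕ) : ℝ :=
  (ρ ^ (C - k) / ((C - k).factorial : ℝ)) /
    ∑ i ∈ Finset.range (C + 1), ρ ^ i / (i.factorial : ℝ)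

lemma sum_pow_div_factorial_pos {ρ : ℝ} (hρ : 0 < ρ) (C : ℕ) :
    0 < ∑ i ∈ Finset.range (C + 1), ρ ^ i / (i.factorial : ℝ) :=
  Finset.sum_pos (fun i _ => by positivity) (by simp)

lemma sum_stationaryIdle {ρ : ℝ} (hρ : 0 < ρ) (C : ℕ) :
    ∑ k ∈ Finset.range (C + 1), stationaryIdle ρ C k = 1 := by
  simp only [stationaryIdle]
  have hrefl := Finset.sum_range_reflect (fun i => ρ ^ i / (i.factorial : ℝ)) (C + 1)
  simp only [Nat.add_sub_cancel] at hrefl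
  rw [← Finset.sum_div, hrefl, div_self (sum_pow_div_factorial_pos hρ C).ne']

/-- Detailed balance across the cut between `k` and `k + 1` idle threads; it makes the drift of the
stationary distribution function vanish. -/
lemma stationaryIdle_balance {l m : ℝ} (hm : m ≠ 0) {C k : ℕ} (hk : k < C) :
    l * stationaryIdle (l / m) C (k + 1) = ((C : ℝ) - k) * m * stationaryIdle (l / m) C k := by
  obtain ⟨j, rfl⟩ := Nat.exists_eq_add_of_lt hk
  rw [stationaryIdle, stationaryIdle, show k + j + 1 - (k + 1) = j by omega,
    show k + j + 1 - k = j + 1 by omega, mul_div_assoc', mul_div_assoc']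
  rw [Nat.factorial_succ, pow_succ]
  push_cast
  field_simp
  ring

lemma stationaryIdle_one_eq_erlangB {ρ : ℝ} (hρ : 0 < ρ) {C : ℕ} (hC : 1 ≤ C) :
    stationaryIdle ρ C 1 = erlangB ρ (C - 1) * (1 - erlangB ρ C) := by
  obtain ⟨n, rfl⟩ := Nat.exists_eq_add_of_le' hC
  have h1 := (sum_pow_div_factorial_pos hρ n).ne'
  have h2 := (sum_pow_div_factorial_pos hρ (n + 1)).ne'
  simp only [stationaryIdle, erlangB, Nat.add_sub_cancel]
  have h3 := Finset.sum_range_succ (fun i => ρ ^ i / (i.factorial : ℝ)) (n + 1)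
  -- `1 - B(ρ, n + 1)` is the ratio of the two consecutive partial sums, and its numerator cancels
  -- the denominator of `B(ρ, n)`.
  rw [one_sub_div h2, ← eq_sub_iff_add_eq.2 h3.symm]
  field_simp

/-! ### Convergence to the stationary law. -/

section Convergence

variable {Ω : Type*} {m : MeasurableSpace Ω} {ℱ : Filtration ℝ≥0 m} {P : Measure Ω}
  {C : ℕ} {lam mu : ℝ≥0} {A : ℝ≥0 → Ω → ℕ} {idle : ℝ≥0 → Ω → Finset (Fin C)}
  {D : Fin C → ℝ≥0 → Ω → ℕ}

/-- The difference between the distribution function of `c(t)` and the stationary one, shifted by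
one so that it vanishes at `0`. -/
noncomputable def cdfError (P : Measure Ω) (idle : ℝ≥0 → Ω → Finset (Fin C)) (ρ : ℝ) (t : ℝ≥0)
    (k : ℕ) : ℝ :=
  P.real {ω | idleCount idle t ω < k} - ∑ i ∈ Finset.range k, stationaryIdle ρ C i

lemma cdfError_zero (ρ : ℝ) (t : ℝ≥0) : cdfError P idle ρ t 0 = 0 := by
  simp [cdfError]

variable [IsProbabilityMeasure P]

lemma cdfError_last {ρ : ℝ} (hρ : 0 < ρ) (t : ℝ≥0) : cdfError P idle ρ t (C + 1) = 0 := by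
  have : {ω | idleCount idle t ω < C + 1} = univ := by
    refine eq_univ_of_forall fun ω => Nat.lt_succ_of_le ?_
    exact (Finset.card_le_univ _).trans_eq (Fintype.card_fin C)
  rw [cdfError, sum_stationaryIdle hρ, this, probReal_univ, sub_self]

lemma IsLossServer.cdfError_succ_sub (h : IsLossServer ℱ P C lam A idle) (ρ : ℝ) (t : ℝ≥0)
    (k : ℕ) : cdfError P idle ρ t (k + 1) - cdfError P idle ρ t k =
      P.real {ω | idleCount idle t ω = k} - stationaryIdle ρ C k := by
  have hu : {ω | idleCount idle t ω < k + 1} =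
      {ω | idleCount idle t ω < k} ∪ {ω | idleCount idle t ω = k} := by
    ext ω
    simp only [mem_ofPred_eq, mem_union]
    omega
  have hd : Disjoint {ω | idleCount idle t ω < k} {ω | idleCount idle t ω = k} :=
    Set.disjoint_left.2 fun ω h1 h2 => (ne_of_lt h1) h2
  rw [cdfError, cdfError, Finset.sum_range_succ, hu, measureReal_union hd
    (ℱ.le _ _ (h.measurableSet_idle t fun I => I.card = k))]
  ring

/-- The law of `c(t)` approaches the stationary law exponentially fast. -/
lemma HasServiceRate.sum_abs_cdfError_le (hS : HasServiceRate ℱ P C mu A D idle)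
    (h : IsLossServer ℱ P C lam A idle) (hC : 1 ≤ C) (hlam : 0 < lam) (hmu : 0 < mu) (t : ℝ≥0) :
    ∑ k ∈ Finset.range C, |cdfError P idle (lam / mu) t (k + 1)| ≤
      Real.exp (-(mu * t)) * ∑ k ∈ Finset.range C, |cdfError P idle (lam / mu) 0 (k + 1)| := by
  have hlam' : (0 : ℝ) < lam := hlam
  have hmu' : (0 : ℝ) < mu := hmu
  have hC' : (1 : ℝ) ≤ C := by exact_mod_cast hC
  obtain ⟨M, hM0, hM⟩ := hS.exists_forward_bound h
  refine le_exp_mul_of_step (φ := fun t => ∑ k ∈ Finset.range C,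
    |cdfError P idle (lam / mu) t (k + 1)|) (κ := lam + C * mu) (M := C * M)
    hmu'.le (by nlinarith) (by positivity) (fun s d hd => ?_) t
  refine sum_abs_birth_death_step_le hlam'.le hmu'.le d.coe_nonneg hd (cdfError_zero _ _)
    (cdfError_last (div_pos hlam' hmu') _) fun k hk => ?_
  -- The forward equation is linear and the stationary law solves it exactly, so the error bound
  -- passes to the difference.
  refine le_of_eq_of_le ?_ (hM s d k hk)
  have e1 := h.cdfError_succ_sub (lam / mu) s k
  have e2 := h.cdfError_succ_sub (lam / mu) s (k + 1)
  have e3 := stationaryIdle_balance (l := lam) hmu'.ne' hk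
  rw [e1, e2]
  simp only [cdfError, Nat.lt_succ_iff]
  congr 1
  linear_combination (d : ℝ) * e3

lemma abs_cdfError_le_sum {ρ : ℝ} (hρ : 0 < ρ) (t : ℝ≥0) {k : ℕ} (hk : k ≤ C) :
    |cdfError P idle ρ t (k + 1)| ≤ ∑ i ∈ Finset.range C, |cdfError P idle ρ t (i + 1)| := by
  rcases hk.eq_or_lt with rfl | hk
  · rw [cdfError_last hρ, abs_zero]
    exact Finset.sum_nonneg fun i _ => abs_nonneg _
  · exact Finset.single_le_sum (f := fun i => |cdfError P idle ρ t (i + 1)|)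
      (fun i _ => abs_nonneg _) (Finset.mem_range.2 hk)

lemma HasServiceRate.tendsto_measureReal_idleCount_eq_one
    (hS : HasServiceRate ℱ P C mu A D idle) (h : IsLossServer ℱ P C lam A idle) (hC : 1 ≤ C)
    (hlam : 0 < lam) (hmu : 0 < mu) :
    Tendsto (fun t : ℝ≥0 => P.real {ω | idleCount idle t ω = 1}) atTop
      (𝓝 (stationaryIdle (lam / mu) C 1)) := by
  have hmu' : (0 : ℝ) < mu := hmu
  have hρ : (0 : ℝ) < lam / mu := div_pos hlam hmu'
  set S := ∑ k ∈ Finset.range C, |cdfError P idle (lam / mu) 0 (k + 1)|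
  have hexp : Tendsto (fun t : ℝ≥0 => 2 * (Real.exp (-(mu * t)) * S)) atTop (𝓝 0) := by
    have h1 : Tendsto (fun t : ℝ≥0 => (mu : ℝ) * t) atTop atTop :=
      (NNReal.tendsto_coe_atTop.2 tendsto_id).const_mul_atTop hmu'
    simpa using ((Real.tendsto_exp_neg_atTop_nhds_zero.comp h1).mul_const S).const_mul 2
  rw [tendsto_iff_norm_sub_tendsto_zero]
  refine squeeze_zero (fun _ => norm_nonneg _) (fun t => ?_) hexp
  -- A point probability is a difference of two values of the distribution function, whence the
  -- factor `2` in `hexp`.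
  rw [← h.cdfError_succ_sub, Real.norm_eq_abs]
  have h0 := hS.sum_abs_cdfError_le h hC hlam hmu t
  have h1 := (abs_cdfError_le_sum (P := P) (idle := idle) hρ t hC).trans h0
  have h2 := (abs_cdfError_le_sum (P := P) (idle := idle) hρ t (zero_le (a := C))).trans h0
  exact (abs_sub _ _).trans (by linarith)

end Convergence

theorem lemma3 {Ω : Type*} {m : MeasurableSpace Ω} (P : Measure Ω) [IsProbabilityMeasure P]
    (ℱ : Filtration ℝ≥0 m) (C : ℕ) (hC : 1 ≤ C) (lam mu : ℝ≥0) (hlam : 0 < lam) (hmu : 0 < mu)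
    (A : ℝ≥0 → Ω → ℕ) (idle : ℝ≥0 → Ω → Finset (Fin C))
    (hserver : IsLossServer ℱ P C lam A idle)
    (ρ P₁ : ℝ) (hρ : ρ = (lam : ℝ) / (mu : ℝ))
    (hP₁ : P₁ = (ρ ^ (C - 1) / ((C - 1).factorial : ℝ)) /
      ∑ k ∈ Finset.range (C + 1), ρ ^ k / (k.factorial : ℝ)) :
    -- for every service mechanism: in steady state, the exhaustion rate is `λ Pr{c = 1}`
    (InSteadyState P (idleCount idle) →
      IsExhaustionRate P (idleCount idle)
        ((lam : ℝ) * P.real {ω | idleCount idle 0 ω = 1})) ∧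
    -- service rate `μ` per thread
    (∀ D : Fin C → ℝ≥0 → Ω → ℕ, HasServiceRate ℱ P C mu A D idle →
      -- in steady state
      (InSteadyState P (idleCount idle) →
        (∀ t, P.real {ω | idleCount idle t ω = 1} = P₁) ∧
        IsExhaustionRate P (idleCount idle) ((lam : ℝ) * P₁)) ∧
      -- in the long run, from every initial state
      Tendsto (fun t : ℝ≥0 => P.real {ω | idleCount idle t ω = 1}) atTop (𝓝 P₁) ∧
      Tendsto (fun t : ℝ≥0 => meanExhaustions P (idleCount idle) 0 t / (t : ℝ≥0∞)) atTop
        (𝓝 (ENNReal.ofReal ((lam : ℝ) * P₁)))) ∧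
    -- the expression of `P₁` through the Erlang-B formula
    P₁ = erlangB ρ (C - 1) * (1 - erlangB ρ C) := by
  have hρ0 : (0 : ℝ) < lam / mu := div_pos hlam hmu
  have hP : P₁ = stationaryIdle (lam / mu) C 1 := by rw [hP₁, hρ]; rfl
  refine ⟨hserver.isExhaustionRate, fun D hD => ?_, ?_⟩
  · have hlim := hD.tendsto_measureReal_idleCount_eq_one hserver hC hlam hmu
    rw [← hP] at hlim
    refine ⟨fun hs => ?_, hlim, hserver.tendsto_meanExhaustions_div hlim⟩
    have hconst : ∀ t, P.real {ω | idleCount idle t ω = 1} =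
        P.real {ω | idleCount idle 0 ω = 1} := fun t => congrArg ENNReal.toReal (hs t 1)
    -- In steady state the convergent function is constant, so it equals its limit.
    have h0 : P.real {ω | idleCount idle 0 ω = 1} = P₁ := by
      simp_rw [hconst] at hlim
      exact tendsto_nhds_unique tendsto_const_nhds hlim
    exact ⟨fun t => (hconst t).trans h0, h0 ▸ hserver.isExhaustionRate hs⟩
  · rw [hP, hρ]
    exact stationaryIdle_one_eq_erlangB hρ0 hC
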